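/- **Setting.** Let $\mathcal A=\{\alpha\in\mathbb C^4 : |\Re\alpha|=|\Im\alpha|=1,\ \Re\alpha\cdot\Im\alpha=0\}$ and $\ell_3(\alpha)=(\Re\alpha)_1(\Im\alpha)_2-(\Re\alpha)_2(\Im\alpha)_1$. For $\alpha\in\mathcal A$ and an integer $N\ge 1$ let $\Phi_{\alpha,N}(\omega)=a(N)(\alpha\cdot\omega)^N$, $\omega\in\mathbb S^3$, where $\alpha\cdot\omega=\sum_{i=1}^4\alpha_i\omega_i$ and $a(N)>0$ is chosen so that $\|\Phi_{\alpha,N}\|_{L^2(\mathbb S^3)}=1$ (for the surface measure). For $\mathbf p\in\mathbb R^3$ put $$\omega(\mathbf p)=\Big(\tfrac{2p_1}{|\mathbf p|^2+1},\tfrac{2p_2}{|\mathbf p|^2+1},\tfrac{2p_3}{|\mathbf p|^2+1},\tfrac{|\mathbf p|^2-1}{|\mathbf p|^2+1}\Big),$$ $$(Kf)(\mathbf p)=\Big(\tfrac{2}{|\mathbf p|^2+1}\Big)^{3/2}f(\omega(\mathbf p)),\qquad (Jg)(\mathbf p)=\tfrac{2}{|\mathbf p|^2+1}\,g(\mathbf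 p),\qquad (D_rg)(\mathbf p)=r^{3/2}g(r\mathbf p),$$ and let $\mathcal F$ be the unitary Fourier transform on $L^2(\mathbb R^3)$, $\mathcal F g(\mathbf p)=(2\pi)^{-3/2}\int e^{-i\mathbf p\cdot\mathbf x}g(\mathbf x)\,d\mathbf x$. The coherent state of the hydrogen atom is $$\Psi_{\alpha,N}=\mathcal F^{-1}D_{N+1}J^{1/2}K\Phi_{\alpha,N}\in L^2(\mathbb R^3).$$ Let $L_3=-i\big(x_1\frac{\partial}{\partial x_2}-x_2\frac{\partial}{\partial x_1}\big)$, as an unbounded operator on $L^2(\mathbb R^3)$ with domain $\{f\in L^2 : L_3f\in L^2\}$ (derivatives in the sense of distributions); powers of unbounded operators have their natural domains. **Proposition.** Let $B\in\mathbb R$, $\tilde B=-B/2$, and let $m>0$ be an integer. There is a constant $C$, depending only on $B$ and $m$, such that for all integers $N\ge1$ and all $\alpha\in\mathcal A$, with $h=1/(N+1)$, the state $\Psi_{\alpha,N}$ lies in the domain of $(h\tilde BL_3)^m$ and $$\Big|\big\langle\Psi_{\alpha,N},(h\tilde BL_3)^m\Psi_{\alpha,N}\big\rangle_{L^2(\mathbb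 R^3)}-\big(\tilde B\,\ell_3(\alpha)\big)^m\Big|\le\frac{C}{N}.$$ In other words, $\langle\Psi_{\alpha,N},(h\tilde BL_3)^m\Psi_{\alpha,N}\rangle=(\tilde B\ell_3(\alpha))^m+O(N^{-1})$ as $N\to\infty$, uniformly in $\alpha\in\mathcal A$. -/

import Mathlib

open MeasureTheory
open scoped SchwartzMap FourierTransform LineDeriv ENNReal

noncomputable section

namespace ZeemanCoherent

/-! ### Spaces -/

/-- Euclidean space `ℝ³` (position or momentum space). -/
abbrev E3 : Type := EuclideanSpace ℝ (Fin 3)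

/-- Euclidean space `ℝ⁴`. -/
abbrev E4 : Type := EuclideanSpace ℝ (Fin 4)

/-- The unit sphere `𝕊³ ⊂ ℝ⁴`. -/
abbrev S3 : Type := Metric.sphere (0 : E4) 1

/-- The complex Hilbert space `L²(ℝ³)` with respect to Lebesgue measure. -/
abbrev L2R3 : Type := Lp ℂ 2 (volume : Measure E3)

/-- The surface measure `dΩ` on `𝕊³` (of total mass `2π²`). -/
def surfaceMeasure : Measure S3 := (volume : Measure E4).toSphere

/-! ### The parameter set and the classical angular momentum -/

/-- `𝒜 = {α ∈ ℂ⁴ : |Re α| = |Im α| = 1, Re α · Im α = 0}`. -/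
def paramSet : Set (Fin 4 → ℂ) :=
  {α | ∑ i, (α i).re ^ 2 = 1 ∧ ∑ i, (α i).im ^ 2 = 1 ∧ ∑ i, (α i).re * (α i).im = 0}

/-- `ℓ₃(α) = (Re α)₁ (Im α)₂ - (Re α)₂ (Im α)₁`; coordinates are numbered from `0` here. -/
def ell3 (α : Fin 4 → ℂ) : ℝ := (α 0).re * (α 1).im - (α 1).re * (α 0).im

/-! ### Coherent states on the sphere -/

/-- The complex bilinear product `α · ω` of `α ∈ ℂ⁴` and `ω ∈ 𝕊³`. -/
def cdot (α : Fin 4 → ℂ) (ω : S3) : ℂ := ∑ i, α i * ((ω.1 i : ℝ) : ℂ)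

/-- The positive constant `a(N)` that normalizes `ω ↦ a(N) (α · ω)^N` in `L²(𝕊³)`. By rotation
invariance its value is the same for every `α ∈ 𝒜`. -/
def normConst (α : Fin 4 → ℂ) (N : ℕ) : ℝ :=
  (√(∫ ω, ‖cdot α ω ^ N‖ ^ 2 ∂surfaceMeasure))⁻¹

/-- The coherent state `Φ_{α,N}(ω) = a(N) (α · ω)^N` on `𝕊³`. -/
def Phi (α : Fin 4 → ℂ) (N : ℕ) (ω : S3) : ℂ := (normConst α N : ℂ) * cdot α ω ^ N

/-! ### Coherent states in momentum space -/

/-- Coordinates of the inverse stereographic projection `ℝ³ → 𝕊³ ∖ {north pole}`. -/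
def stereoVec (p : E3) : E4 :=
  !₂[2 / (‖p‖ ^ 2 + 1) * p 0, 2 / (‖p‖ ^ 2 + 1) * p 1, 2 / (‖p‖ ^ 2 + 1) * p 2,
    (‖p‖ ^ 2 - 1) / (‖p‖ ^ 2 + 1)]

theorem stereoVec_mem (p : E3) : stereoVec p ∈ Metric.sphere (0 : E4) 1 := by
  have h : ‖p‖ ^ 2 = p 0 ^ 2 + p 1 ^ 2 + p 2 ^ 2 := by
    rw [EuclideanSpace.real_norm_sq_eq, Fin.sum_univ_three]
  have hpos : ‖p‖ ^ 2 + 1 ≠ 0 := by positivity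
  have h2 : ‖stereoVec p‖ ^ 2 = 1 := by
    rw [EuclideanSpace.real_norm_sq_eq, Fin.sum_univ_four]
    simp only [stereoVec, PiLp.toLp_apply, Matrix.cons_val]
    field_simp
    linear_combination (-4 : ℝ) * h
  rw [mem_sphere_zero_iff_norm]
  nlinarith [norm_nonneg (stereoVec p)]

/-- The inverse stereographic projection `p ↦ ω(p)`. -/
def stereo (p : E3) : S3 := ⟨stereoVec p, stereoVec_mem p⟩

/-- The operator `K`, `(K f)(p) = (2 / (|p|² + 1))^{3/2} f(ω(p))`. -/
def opK (f : S3 → ℂ) (p : E3) : ℂ := (((2 / (‖p‖ ^ 2 + 1)) ^ (3 / 2 : ℝ) : ℝ) : ℂ) * f (stereo p)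

/-- The square root `J^{1/2}` of multiplication by `2 / (|p|² + 1)`. -/
def opJhalf (f : E3 → ℂ) (p : E3) : ℂ := (((2 / (‖p‖ ^ 2 + 1)) ^ (1 / 2 : ℝ) : ℝ) : ℂ) * f p

/-- The dilation `(D_r f)(x) = r^{3/2} f(r x)`, unitary on `L²(ℝ³)` for `r > 0`. -/
def dilation (r : ℝ) (f : E3 → ℂ) (x : E3) : ℂ := ((r ^ (3 / 2 : ℝ) : ℝ) : ℂ) * f (r • x)

/-- The coherent state in momentum space, `D_{N+1} J^{1/2} K Φ_{α,N}`. -/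
def hatPsi (α : Fin 4 → ℂ) (N : ℕ) : E3 → ℂ :=
  dilation (N + 1) (opJhalf (opK (Phi α N)))

theorem continuous_stereo : Continuous stereo := by
  refine Continuous.subtype_mk ?_ _
  unfold stereoVec
  have hne : ∀ p : E3, ‖p‖ ^ 2 + 1 ≠ 0 := fun p => by positivity
  refine (PiLp.continuous_toLp 2 _).comp (continuous_pi fun i => ?_)
  fin_cases i <;> simp only [Fin.zero_eta, Fin.mk_one, Fin.reduceFinMk, Matrix.cons_val] <;>
    fun_prop (disch := exact hne _)

theorem continuous_Phi (α : Fin 4 → ℂ) (N : ℕ) : Continuous (Phi α N) := by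
  unfold Phi cdot
  fun_prop

theorem opJhalf_opK (f : S3 → ℂ) (p : E3) :
    opJhalf (opK f) p = (((2 / (‖p‖ ^ 2 + 1)) ^ 2 : ℝ) : ℂ) * f (stereo p) := by
  have h : (0 : ℝ) < 2 / (‖p‖ ^ 2 + 1) := by positivity
  have h2 : (2 / (‖p‖ ^ 2 + 1)) ^ (1 / 2 : ℝ) * (2 / (‖p‖ ^ 2 + 1)) ^ (3 / 2 : ℝ)
      = (2 / (‖p‖ ^ 2 + 1)) ^ 2 := by
    rw [← Real.rpow_add h]
    norm_num
  unfold opJhalf opK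
  rw [← mul_assoc, ← Complex.ofReal_mul, h2]

theorem memLp_opJhalf_opK (α : Fin 4 → ℂ) (N : ℕ) :
    MemLp (opJhalf (opK (Phi α N))) 2 (volume : Measure E3) := by
  have hfun : opJhalf (opK (Phi α N)) =
      fun p => (((2 / (‖p‖ ^ 2 + 1)) ^ 2 : ℝ) : ℂ) * Phi α N (stereo p) :=
    funext fun p => opJhalf_opK _ p
  have hne : ∀ p : E3, ‖p‖ ^ 2 + 1 ≠ 0 := fun p => by positivity
  have hcont : Continuous (opJhalf (opK (Phi α N))) := by
    rw [hfun]
    have h1 := (continuous_Phi α N).comp continuous_stereo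
    have h2 : Continuous fun p : E3 => (2 / (‖p‖ ^ 2 + 1)) ^ 2 := by
      fun_prop (disch := exact hne _)
    exact (Complex.continuous_ofReal.comp h2).mul h1
  obtain ⟨C, hC⟩ := (isCompact_range (continuous_Phi α N)).isBounded.exists_norm_le
  rw [memLp_two_iff_integrable_sq_norm hcont.aestronglyMeasurable]
  have hint : Integrable (fun p : E3 => (1 + ‖p‖ ^ 2) ^ (-(8 : ℝ) / 2)) volume :=
    integrable_rpow_neg_one_add_norm_sq (by simp; norm_num)
  refine (hint.const_mul (16 * C ^ 2)).mono' (hcont.norm.pow 2).aestronglyMeasurable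
    (Filter.Eventually.of_forall fun p => ?_)
  have hb : ‖Phi α N (stereo p)‖ ≤ C := hC _ ⟨_, rfl⟩
  have hpos : (0 : ℝ) < 1 + ‖p‖ ^ 2 := by positivity
  have he : (1 + ‖p‖ ^ 2) ^ (-(8 : ℝ) / 2) = ((1 + ‖p‖ ^ 2) ^ 4)⁻¹ := by
    rw [show (-(8 : ℝ) / 2) = -((4 : ℕ) : ℝ) by norm_num, Real.rpow_neg hpos.le,
      Real.rpow_natCast]
  rw [hfun, he, norm_mul, Complex.norm_real, Real.norm_of_nonneg (by positivity),
    Real.norm_of_nonneg (by positivity), mul_pow,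
    show ((2 / (‖p‖ ^ 2 + 1)) ^ 2) ^ 2 = 16 * ((1 + ‖p‖ ^ 2) ^ 4)⁻¹ by
      rw [add_comm (‖p‖ ^ 2) 1]; field_simp; norm_num]
  have hsq : ‖Phi α N (stereo p)‖ ^ 2 ≤ C ^ 2 := by gcongr
  calc _ ≤ 16 * ((1 + ‖p‖ ^ 2) ^ 4)⁻¹ * C ^ 2 := by gcongr
    _ = _ := by ring

theorem memLp_dilation {r : ℝ} (hr : r ≠ 0) {f : E3 → ℂ} (hf : MemLp f 2 (volume : Measure E3)) :
    MemLp (dilation r f) 2 (volume : Measure E3) := by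
  refine MemLp.const_mul ?_ _
  have hm : Measurable fun x : E3 => r • x := measurable_const_smul r
  have hmap := Measure.map_addHaar_smul (volume : Measure E3) hr
  refine MemLp.comp_of_map ?_ hm.aemeasurable
  rw [hmap]
  exact hf.smul_measure ENNReal.ofReal_ne_top

theorem memLp_hatPsi (α : Fin 4 → ℂ) (N : ℕ) : MemLp (hatPsi α N) 2 (volume : Measure E3) :=
  memLp_dilation (by positivity) (memLp_opJhalf_opK α N)

/-! ### Coherent states in configuration space -/

/-- The inverse on `L²(ℝ³)` of the unitary Fourier transform
`(ℱ g)(p) = (2π)^{-3/2} ∫ e^{-i p·x} g(x) dx`. Mathlib's unitary transform `𝓕` has the kernel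
`e^{-2πi ξ·x}`, so that `ℱ = D_{1/(2π)} 𝓕` and `ℱ⁻¹ = 𝓕⁻¹ D_{2π}`. -/
def invFourier (g : E3 → ℂ) (hg : MemLp g 2 (volume : Measure E3)) : L2R3 :=
  𝓕⁻ ((memLp_dilation (r := 2 * Real.pi) (by positivity) hg).toLp (dilation (2 * Real.pi) g))

/-- The coherent state `Ψ_{α,N} = ℱ⁻¹ D_{N+1} J^{1/2} K Φ_{α,N} ∈ L²(ℝ³)` of the hydrogen atom. -/
def Psi (α : Fin 4 → ℂ) (N : ℕ) : L2R3 := invFourier (hatPsi α N) (memLp_hatPsi α N)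

/-! ### The angular momentum operator -/

/-- The `i`-th standard unit vector of `ℝ³`. -/
def e3 (i : Fin 3) : E3 := EuclideanSpace.single i 1

/-- Multiplication of a tempered distribution by the coordinate function `x_i`. -/
def mulCoord (i : Fin 3) : 𝓢'(E3, ℂ) →L[ℂ] 𝓢'(E3, ℂ) :=
  TemperedDistribution.smulLeftCLM ℂ (fun x : E3 => ((x i : ℝ) : ℂ))

/-- The differential operator `-i (x₁ ∂/∂x₂ - x₂ ∂/∂x₁)` acting on tempered distributions
(coordinates are numbered from `0` in the code). -/
def distL3 (T : 𝓢'(E3, ℂ)) : 𝓢'(E3, ℂ) :=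
  (-Complex.I) • (mulCoord 0 (∂_{e3 1} T) - mulCoord 1 (∂_{e3 0} T))

/-- The graph of `L₃`: pairs `(f, g)` in `L²(ℝ³)` with `-i (x₁ ∂₂ - x₂ ∂₁) f = g` in the sense of
tempered distributions. -/
def graphL3 : Submodule ℂ (L2R3 × L2R3) where
  carrier := {u | distL3 (u.1 : 𝓢'(E3, ℂ)) = (u.2 : 𝓢'(E3, ℂ))}
  add_mem' := by
    rintro ⟨f, g⟩ ⟨f', g'⟩ h h'
    simp only [Set.mem_ofPred_eq, Prod.mk_add_mk, ← Lp.toTemperedDistributionCLM_apply] at h h' ⊢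
    rw [map_add, map_add, ← h, ← h']
    simp only [distL3, LineDerivAdd.lineDerivOp_add, map_add, smul_sub, smul_add]
    abel
  zero_mem' := by
    simp only [Set.mem_ofPred_eq, Prod.fst_zero, Prod.snd_zero,
      ← Lp.toTemperedDistributionCLM_apply, map_zero]
    have h : ∀ v : E3, (∂_{v} (0 : 𝓢'(E3, ℂ))) = 0 := fun v => by
      exact (LineDeriv.lineDerivOpCLM ℂ 𝓢'(E3, ℂ) v).map_zero
    simp [distL3, h]
  smul_mem' := by
    rintro c ⟨f, g⟩ h
    simp only [Set.mem_ofPred_eq, Prod.smul_mk, ← Lp.toTemperedDistributionCLM_apply] at h ⊢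
    rw [map_smul, map_smul, ← h]
    simp only [distL3, LineDerivSMul.lineDerivOp_smul, map_smul, smul_sub]
    rw [smul_comm c, smul_comm c]

/-- The third component `L₃ = -i (x₁ ∂/∂x₂ - x₂ ∂/∂x₁)` of the angular momentum, as an unbounded
operator on `L²(ℝ³)` with the natural domain `{f ∈ L² : L₃ f ∈ L²}`. -/
def L3 : L2R3 →ₗ.[ℂ] L2R3 := graphL3.toLinearPMap

theorem graph_L3 : L3.graph = graphL3 := by
  refine Submodule.toLinearPMap_graph_eq _ ?_
  rintro ⟨f, g⟩ h hf
  simp only at hf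
  subst hf
  have h0 := graphL3.zero_mem
  have h' : distL3 ((0 : L2R3) : 𝓢'(E3, ℂ)) = (g : 𝓢'(E3, ℂ)) := h
  have h0' : distL3 ((0 : L2R3) : 𝓢'(E3, ℂ)) = ((0 : L2R3) : 𝓢'(E3, ℂ)) := h0
  have hg : g ∈ (Lp.toTemperedDistributionCLM ℂ (volume : Measure E3) 2).ker := by
    rw [LinearMap.mem_ker]
    have := h'.symm.trans h0'
    simpa [← Lp.toTemperedDistributionCLM_apply] using this
  rw [Lp.ker_toTemperedDistributionCLM_eq_bot] at hg
  exact hg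

/-- `f ∈ dom L₃` and `L₃ f = g` if and only if `-i (x₁ ∂₂ - x₂ ∂₁) f = g` as distributions. -/
theorem mem_graph_L3_iff (f g : L2R3) :
    (f, g) ∈ L3.graph ↔ distL3 (f : 𝓢'(E3, ℂ)) = (g : 𝓢'(E3, ℂ)) := by
  rw [graph_L3]
  rfl

/-! ### Powers of unbounded operators -/

/-- The composition `S T` of unbounded operators, with domain `{f ∈ dom T : T f ∈ dom S}`. -/
def opComp {H : Type*} [AddCommGroup H] [Module ℂ H] (S T : H →ₗ.[ℂ] H) : H →ₗ.[ℂ] H where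
  domain := (S.domain.comap T.toFun).map T.domain.subtype
  toFun := S.toFun.comp
    ((T.toFun.comp (Submodule.inclusion (Submodule.map_subtype_le _ _))).codRestrict S.domain (by
      rintro ⟨f, hf⟩
      obtain ⟨u, hu, rfl⟩ := hf
      exact hu))

/-- The power `T^k` of an unbounded operator: `T⁰` is the identity and `T^{k+1} = T T^k`. -/
def opPow {H : Type*} [AddCommGroup H] [Module ℂ H] (T : H →ₗ.[ℂ] H) : ℕ → (H →ₗ.[ℂ] H)
  | 0 => (LinearMap.id : H →ₗ[ℂ] H).toPMap ⊤
  | k + 1 => opComp T (opPow T k)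

end ZeemanCoherent

end

open ZeemanCoherent

/-! ### Moments of sums of independent discrete variables -/

section Moments

variable {ι : Type*} [Fintype ι]

/-! The expectation value is exactly a moment of a sum of independent discrete variables, so the
estimate is a quantitative law of large numbers.

Split `α` into its components `eigComp α a` in the eigenspaces, with eigenvalues `1, -1, 0`, of
rotation in the first two coordinates, and expand `(α · ω)^N` over all maps `σ : Fin N → Fin 3`.
Each product picks up the character of weight `X σ = ∑ k, eigVal (σ k)` under rotations about the
third axis. Stereographic projection, the radial factors and the dilations respect these rotations,
and `L₃` commutes with the inverse Fourier transform. Hence each product gives an eigenvector of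
`L₃` with eigenvalue `X σ` (`mem_graph_L3_sphereState`). This settles the domain question, since the
sum is finite.

It remains to pair the components with `Ψ`. The factor `J^{1/2}` turns the inner product of `L²(𝕊³)`
into that of `(1 - ω₄) dΩ` (`inner_sphereState`). The `ω₄` term integrates an odd function and
vanishes. For the rest, polar coordinates convert the sphere integral into a Gaussian one.
Integrating by parts there, and using that `conj α` is isotropic, factors the pairing of `(α · ω)^N`
with a product of linear forms into Hermitian products with `α`
(`exists_integral_conj_linC_pow_mul_prod`). After normalization the pairing with the component of
`σ` is `∏ k, eigWeight α (σ k)` (`inner_Psi_phiComp`).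

The `eigWeight α a` are probabilities, and the mean of `eigVal` under them is `ell3 α`. So the
expectation is `(-B/2)^m` times the `m`-th moment of `X / (N + 1)`. A second order Taylor expansion
about the mean, with bias and variance of order `1 / N`, concludes (`abs_moment_sub_pow_le`). -/

theorem sum_fin_succ_fun {M : Type*} [AddCommMonoid M] (N : ℕ) (F : (Fin (N + 1) → ι) → M) :
    ∑ σ, F σ = ∑ a, ∑ σ : Fin N → ι, F (Fin.cons a σ) := by
  rw [← Fintype.sum_prod_type']
  exact (Fintype.sum_equiv (Fin.consEquiv fun _ => ι) _ _ fun _ => rfl).symm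

theorem sum_prod_fun_eq_one {p : ι → ℝ} (hp : ∑ a, p a = 1) (N : ℕ) :
    ∑ σ : Fin N → ι, ∏ k, p (σ k) = 1 := by
  rw [← Fintype.sum_pow, hp, one_pow]

theorem sum_prod_mul_centered {p ε : ι → ℝ} {l : ℝ} (hp : ∑ a, p a = 1)
    (hl : ∑ a, p a * ε a = l) (N : ℕ) :
    ∑ σ : Fin N → ι, (∏ k, p (σ k)) * (∑ k, ε (σ k) - N * l) = 0 := by
  induction N with
  | zero => simp
  | succ N ih =>
    rw [sum_fin_succ_fun]
    have h : ∀ a, ∑ σ : Fin N → ι, (∏ k, p ((Fin.cons a σ : Fin (N + 1) → ι) k)) *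
        (∑ k, ε ((Fin.cons a σ : Fin (N + 1) → ι) k) - (N + 1 : ℕ) * l) = p a * ε a - l * p a := by
      intro a
      simp only [Fin.prod_univ_succ, Fin.sum_univ_succ, Fin.cons_zero, Fin.cons_succ]
      calc _ = ∑ σ : Fin N → ι, (p a * ((∏ k, p (σ k)) * (∑ k, ε (σ k) - N * l))
            + (p a * ε a - l * p a) * ∏ k, p (σ k)) :=
            Finset.sum_congr rfl fun σ _ => by push_cast; ring
        _ = _ := by
          rw [Finset.sum_add_distrib, ← Finset.mul_sum, ← Finset.mul_sum, ih,
            sum_prod_fun_eq_one hp]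
          ring
    simp only [h]
    rw [Finset.sum_sub_distrib, ← Finset.mul_sum, hp, hl]
    ring

/-- Variances of independent variables add: when one factor is split off, the cross term vanishes by
`sum_prod_mul_centered`. -/
theorem sum_prod_mul_centered_sq {p ε : ι → ℝ} {l : ℝ} (hp : ∑ a, p a = 1)
    (hl : ∑ a, p a * ε a = l) (N : ℕ) :
    ∑ σ : Fin N → ι, (∏ k, p (σ k)) * (∑ k, ε (σ k) - N * l) ^ 2
      = N * ∑ a, p a * (ε a - l) ^ 2 := by
  induction N with
  | zero => simp
  | succ N ih =>
    rw [sum_fin_succ_fun]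
    have h : ∀ a, ∑ σ : Fin N → ι, (∏ k, p ((Fin.cons a σ : Fin (N + 1) → ι) k)) *
        (∑ k, ε ((Fin.cons a σ : Fin (N + 1) → ι) k) - (N + 1 : ℕ) * l) ^ 2
          = (N * ∑ a, p a * (ε a - l) ^ 2) * p a + p a * (ε a - l) ^ 2 := by
      intro a
      simp only [Fin.prod_univ_succ, Fin.sum_univ_succ, Fin.cons_zero, Fin.cons_succ]
      calc _ = ∑ σ : Fin N → ι, (p a * ((∏ k, p (σ k)) * (∑ k, ε (σ k) - N * l) ^ 2)
            + (2 * p a * (ε a - l) * ((∏ k, p (σ k)) * (∑ k, ε (σ k) - N * l))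
            + p a * (ε a - l) ^ 2 * ∏ k, p (σ k))) :=
            Finset.sum_congr rfl fun σ _ => by push_cast; ring
        _ = _ := by
          rw [Finset.sum_add_distrib, Finset.sum_add_distrib, ← Finset.mul_sum, ← Finset.mul_sum,
            ← Finset.mul_sum, ih, sum_prod_fun_eq_one hp, sum_prod_mul_centered hp hl]
          ring
    simp only [h]
    rw [Finset.sum_add_distrib, ← Finset.mul_sum, hp]
    push_cast
    ring

/-- Second order Taylor estimate for `x ^ m` on `[-1, 1]`. -/
theorem abs_pow_sub_taylor_le {x y : ℝ} (hx : |x| ≤ 1) (hy : |y| ≤ 1) (m : ℕ) :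
    |x ^ m - y ^ m - m * y ^ (m - 1) * (x - y)| ≤ m ^ 2 * (x - y) ^ 2 := by
  induction m with
  | zero => simp
  | succ m ih =>
    -- The Taylor remainders satisfy `R (m+1) = x * R m + m * y^(m-1) * (x-y)^2`, and `m^2 + m ≤
    -- (m+1)^2` closes the induction. The case `m = 0` is separate because `m - 1` is truncated.
    have key : x ^ (m + 1) - y ^ (m + 1) - (m + 1 : ℕ) * y ^ (m + 1 - 1) * (x - y)
        = x * (x ^ m - y ^ m - m * y ^ (m - 1) * (x - y)) + m * y ^ (m - 1) * (x - y) ^ 2 := by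
      rcases m with _ | m
      · simp
      · push_cast [Nat.add_sub_cancel]
        ring
    rw [key]
    have h1 : |x * (x ^ m - y ^ m - m * y ^ (m - 1) * (x - y))| ≤ m ^ 2 * (x - y) ^ 2 := by
      rw [abs_mul]
      nlinarith [abs_nonneg x, abs_nonneg (x ^ m - y ^ m - m * y ^ (m - 1) * (x - y))]
    have h2 : |m * y ^ (m - 1) * (x - y) ^ 2| ≤ m * (x - y) ^ 2 := by
      rw [abs_mul, abs_mul, abs_pow, Nat.abs_cast, abs_of_nonneg (sq_nonneg (x - y))]
      have : |y| ^ (m - 1) ≤ 1 := pow_le_one₀ (abs_nonneg _) hy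
      have : (m : ℝ) * |y| ^ (m - 1) ≤ m := mul_le_of_le_one_right (by positivity) this
      gcongr
    refine (abs_add_le _ _).trans ((add_le_add h1 h2).trans ?_)
    push_cast
    nlinarith [sq_nonneg (x - y), (Nat.cast_nonneg m : (0 : ℝ) ≤ m)]

/-- The moments of the normalized sum of `N` independent copies of a variable with values in
`[-1, 1]` converge to the powers of the mean at rate `1 / N`. -/
theorem abs_moment_sub_pow_le {p ε : ι → ℝ} {l : ℝ} (hp0 : ∀ a, 0 ≤ p a) (hp : ∑ a, p a = 1)
    (hε : ∀ a, |ε a| ≤ 1) (hl : ∑ a, p a * ε a = l) (m : ℕ) {N : ℕ} (hN : 1 ≤ N) :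
    |∑ σ : Fin N → ι, (∏ k, p (σ k)) * ((∑ k, ε (σ k)) / (N + 1)) ^ m - l ^ m|
      ≤ (m + m ^ 2) / N := by
  have hN0 : (0 : ℝ) < N := by exact_mod_cast hN
  have hl1 : |l| ≤ 1 := by
    rw [← hl, ← hp]
    refine (Finset.abs_sum_le_sum_abs _ _).trans (Finset.sum_le_sum fun a _ => ?_)
    rw [abs_mul, abs_of_nonneg (hp0 a)]
    exact mul_le_of_le_one_right (hp0 a) (hε a)
  set P : (Fin N → ι) → ℝ := fun σ => ∏ k, p (σ k) with hP
  set x : (Fin N → ι) → ℝ := fun σ => (∑ k, ε (σ k)) / (N + 1) with hx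
  have hP0 : ∀ σ, 0 ≤ P σ := fun σ => Finset.prod_nonneg fun k _ => hp0 _
  have hx1 : ∀ σ, |x σ| ≤ 1 := by
    intro σ
    rw [hx, abs_div, abs_of_pos (by positivity : (0 : ℝ) < N + 1), div_le_one (by positivity)]
    calc _ ≤ ∑ k : Fin N, |ε (σ k)| := Finset.abs_sum_le_sum_abs _ _
      _ ≤ ∑ k : Fin N, (1 : ℝ) := Finset.sum_le_sum fun k _ => hε _
      _ ≤ _ := by simp
  have h0 : ∑ σ, P σ = 1 := sum_prod_fun_eq_one hp N
  have hA := sum_prod_mul_centered hp hl N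
  have hV := sum_prod_mul_centered_sq hp hl N
  have hv : ∑ a, p a * (ε a - l) ^ 2 ≤ 1 - l ^ 2 := by
    have : ∑ a, p a * (ε a - l) ^ 2 = ∑ a, p a * ε a ^ 2 - l ^ 2 := by
      calc _ = ∑ a, (p a * ε a ^ 2 - 2 * l * (p a * ε a) + l ^ 2 * p a) :=
            Finset.sum_congr rfl fun a _ => by ring
        _ = _ := by
          rw [Finset.sum_add_distrib, Finset.sum_sub_distrib, ← Finset.mul_sum, ← Finset.mul_sum,
            hl, hp]
          ring
    rw [this, ← hp]
    refine sub_le_sub_right (Finset.sum_le_sum fun a _ => ?_) _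
    exact mul_le_of_le_one_right (hp0 a) ((sq_le_one_iff_abs_le_one _).2 (hε a))
  -- The sum of `N` terms is divided by `N + 1`, so the mean is `N l / (N + 1)`. This bias is why a
  -- first order term survives in `hsplit`.
  have hE1 : ∑ σ, P σ * (x σ - l) = -l / (N + 1) := by
    calc _ = ∑ σ, ((N + 1 : ℝ)⁻¹ * (P σ * (∑ k, ε (σ k) - N * l)) - l / (N + 1) * P σ) :=
          Finset.sum_congr rfl fun σ _ => by simp only [hx]; field_simp; ring
      _ = _ := by
        rw [Finset.sum_sub_distrib, ← Finset.mul_sum, ← Finset.mul_sum, hA, h0]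
        ring
  have hE2 : ∑ σ, P σ * (x σ - l) ^ 2 ≤ 1 / N := by
    have : ∑ σ, P σ * (x σ - l) ^ 2
        = (N * ∑ a, p a * (ε a - l) ^ 2 + l ^ 2) / (N + 1) ^ 2 := by
      calc _ = ∑ σ, ((N + 1 : ℝ)⁻¹ ^ 2 * (P σ * (∑ k, ε (σ k) - N * l) ^ 2)
            - (2 * l * (N + 1 : ℝ)⁻¹ ^ 2 * (P σ * (∑ k, ε (σ k) - N * l))
              - l ^ 2 * (N + 1 : ℝ)⁻¹ ^ 2 * P σ)) :=
            Finset.sum_congr rfl fun σ _ => by simp only [hx]; field_simp; ring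
        _ = _ := by
          rw [Finset.sum_sub_distrib, Finset.sum_sub_distrib, ← Finset.mul_sum, ← Finset.mul_sum,
            ← Finset.mul_sum, hA, h0, hV]
          field_simp
          ring
    -- By `hv` it suffices that `N^2 (1 - l^2) + N l^2 ≤ (N + 1)^2`.
    rw [this, div_le_div_iff₀ (by positivity) hN0]
    have hl2 : l ^ 2 ≤ 1 := (sq_le_one_iff_abs_le_one _).2 hl1
    have hN1 : (1 : ℝ) ≤ N := by exact_mod_cast hN
    nlinarith [mul_le_mul_of_nonneg_left hv (sq_nonneg (N : ℝ)), sq_nonneg l,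
      mul_le_mul_of_nonneg_left hl2 hN0.le, mul_nonneg (sq_nonneg (N : ℝ)) (sq_nonneg l)]
  have hsplit : ∑ σ, P σ * x σ ^ m - l ^ m
      = ∑ σ, P σ * (x σ ^ m - l ^ m - m * l ^ (m - 1) * (x σ - l))
        + m * l ^ (m - 1) * (-l / (N + 1)) := by
    have : ∑ σ, P σ * (x σ ^ m - l ^ m - m * l ^ (m - 1) * (x σ - l))
        = ∑ σ, P σ * x σ ^ m - l ^ m * ∑ σ, P σ
          - m * l ^ (m - 1) * ∑ σ, P σ * (x σ - l) := by
      rw [Finset.mul_sum, Finset.mul_sum, ← Finset.sum_sub_distrib, ← Finset.sum_sub_distrib]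
      exact Finset.sum_congr rfl fun σ _ => by ring
    rw [this, hE1, h0]
    ring
  rw [hsplit]
  refine (abs_add_le _ _).trans ?_
  have h1 : |∑ σ, P σ * (x σ ^ m - l ^ m - m * l ^ (m - 1) * (x σ - l))| ≤ m ^ 2 * (1 / N) := by
    calc _ ≤ ∑ σ, |P σ * (x σ ^ m - l ^ m - m * l ^ (m - 1) * (x σ - l))| :=
          Finset.abs_sum_le_sum_abs _ _
      _ ≤ ∑ σ, m ^ 2 * (P σ * (x σ - l) ^ 2) := by
          refine Finset.sum_le_sum fun σ _ => ?_
          rw [abs_mul, abs_of_nonneg (hP0 σ)]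
          have := mul_le_mul_of_nonneg_left (abs_pow_sub_taylor_le (hx1 σ) hl1 m) (hP0 σ)
          linarith
      _ ≤ _ := by
          rw [← Finset.mul_sum]
          gcongr
  have h2 : |m * l ^ (m - 1) * (-l / (N + 1))| ≤ m * (1 / N) := by
    rw [abs_mul, abs_mul, Nat.abs_cast, abs_pow, abs_div, abs_neg,
      abs_of_pos (by positivity : (0 : ℝ) < N + 1)]
    have e1 : |l| ^ (m - 1) ≤ 1 := pow_le_one₀ (abs_nonneg _) hl1
    have e2 : |l| / ((N : ℝ) + 1) ≤ 1 / N := by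
      gcongr
      linarith
    calc _ ≤ (m * 1) * (1 / (N : ℝ)) := by gcongr
      _ = _ := by ring
  calc _ ≤ m ^ 2 * (1 / (N : ℝ)) + m * (1 / N) := add_le_add h1 h2
    _ = _ := by ring

end Moments

/-! ### The angular momentum operator on tempered distributions -/

theorem mulCoord_eq (i : Fin 3) :
    mulCoord i = TemperedDistribution.smulLeftCLM ℂ (fun x : E3 => ((inner ℝ x (e3 i) : ℝ) : ℂ)) := by
  unfold mulCoord e3
  simp [EuclideanSpace.inner_single_right]

theorem hasTemperateGrowth_coord (i : Fin 3) :
    (fun x : E3 => ((x i : ℝ) : ℂ)).HasTemperateGrowth := by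
  have h : (fun x : E3 => ((x i : ℝ) : ℂ))
      = (fun x : E3 => (Complex.ofRealCLM ∘L EuclideanSpace.proj (𝕜 := ℝ) i) x) := rfl
  rw [h]
  fun_prop

theorem lineDerivOp_fourierInv (T : 𝓢'(E3, ℂ)) (i : Fin 3) :
    ∂_{e3 i} (𝓕⁻ T) = 𝓕⁻ ((2 * Real.pi * Complex.I) • mulCoord i T) := by
  rw [TemperedDistribution.lineDerivOp_fourierInv_eq, mulCoord_eq]

theorem mulCoord_fourierInv (T : 𝓢'(E3, ℂ)) (i : Fin 3) :
    mulCoord i (𝓕⁻ T) = (-(2 * Real.pi * Complex.I))⁻¹ • 𝓕⁻ (∂_{e3 i} T) := by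
  rw [TemperedDistribution.fourierInv_lineDerivOp_eq, mulCoord_eq, inv_smul_smul₀]
  simp [Real.pi_ne_zero, Complex.I_ne_zero]

theorem lineDerivOp_smulLeftCLM_coord {i j : Fin 3} (hij : i ≠ j) (φ : 𝓢(E3, ℂ)) :
    ∂_{e3 j} (SchwartzMap.smulLeftCLM ℂ (fun x : E3 => ((x i : ℝ) : ℂ)) φ)
      = SchwartzMap.smulLeftCLM ℂ (fun x : E3 => ((x i : ℝ) : ℂ)) (∂_{e3 j} φ) := by
  ext x
  rw [SchwartzMap.smulLeftCLM_apply_apply (hasTemperateGrowth_coord i),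
    SchwartzMap.lineDerivOp_apply, SchwartzMap.lineDerivOp_apply]
  have h : ⇑(SchwartzMap.smulLeftCLM ℂ (fun x : E3 => ((x i : ℝ) : ℂ)) φ)
      = fun x : E3 => ((x i : ℝ) : ℂ) * φ x :=
    funext fun x => SchwartzMap.smulLeftCLM_apply_apply (hasTemperateGrowth_coord i) φ x
  rw [h]
  have h1 : HasLineDerivAt ℝ (fun x : E3 => ((x i : ℝ) : ℂ) * φ x)
      (((x i : ℝ) : ℂ) * lineDeriv ℝ φ x (e3 j)) x (e3 j) := by
    have h2 : HasLineDerivAt ℝ φ (lineDeriv ℝ φ x (e3 j)) x (e3 j) :=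
      (φ.differentiableAt.lineDifferentiableAt).hasLineDerivAt
    unfold HasLineDerivAt at h2 ⊢
    have h3 : ∀ t : ℝ, (x + t • e3 j) i = x i := by
      intro t
      simp [e3, hij]
    simp only [h3]
    exact h2.const_mul _
  exact h1.lineDeriv

theorem lineDerivOp_mulCoord {i j : Fin 3} (hij : i ≠ j) (T : 𝓢'(E3, ℂ)) :
    ∂_{e3 j} (mulCoord i T) = mulCoord i (∂_{e3 j} T) := by
  ext φ
  simp only [mulCoord, TemperedDistribution.smulLeftCLM_apply_apply,
    TemperedDistribution.lineDerivOp_apply_apply, map_neg, lineDerivOp_smulLeftCLM_coord hij]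

/-- The Fourier transform exchanges coordinates and derivatives with factors `2πi` and `-(2πi)⁻¹`,
so `x_i ∂_j` becomes `-∂_i x_j`, in which the two factors commute as `i ≠ j`. Antisymmetrization
absorbs the sign, and the normalization of the transform drops out. -/
theorem distL3_fourierInv (T : 𝓢'(E3, ℂ)) : distL3 (𝓕⁻ T) = 𝓕⁻ (distL3 T) := by
  have hc : (2 * Real.pi * Complex.I : ℂ) ≠ 0 := by simp [Real.pi_ne_zero, Complex.I_ne_zero]
  have h : ∀ i j : Fin 3, i ≠ j → mulCoord i (∂_{e3 j} (𝓕⁻ T)) = -𝓕⁻ (mulCoord j (∂_{e3 i} T)) := by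
    intro i j hij
    rw [lineDerivOp_fourierInv, FourierTransform.fourierInv_smul, map_smul, mulCoord_fourierInv,
      smul_smul, inv_neg, mul_neg, mul_inv_cancel₀ hc, neg_one_smul, lineDerivOp_mulCoord hij.symm]
  unfold distL3
  rw [h 0 1 (by decide), h 1 0 (by decide), FourierTransform.fourierInv_smul,
    ← FourierTransform.fourierInvCLM_apply (R := ℂ) (_ - _), map_sub]
  congr 1
  simp only [FourierTransform.fourierInvCLM_apply]
  abel

/-- The angular momentum on Schwartz functions, up to the factor `-i`. -/
noncomputable def rotDeriv (φ : 𝓢(E3, ℂ)) : 𝓢(E3, ℂ) :=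
  SchwartzMap.smulLeftCLM ℂ (fun x : E3 => ((x 0 : ℝ) : ℂ)) (∂_{e3 1} φ)
    - SchwartzMap.smulLeftCLM ℂ (fun x : E3 => ((x 1 : ℝ) : ℂ)) (∂_{e3 0} φ)

theorem distL3_apply (T : 𝓢'(E3, ℂ)) (φ : 𝓢(E3, ℂ)) :
    distL3 T φ = Complex.I * T (rotDeriv φ) := by
  have h : distL3 T φ = (-Complex.I) * (mulCoord 0 (∂_{e3 1} T) φ - mulCoord 1 (∂_{e3 0} T) φ) := rfl
  rw [h, rotDeriv, map_sub, ← lineDerivOp_smulLeftCLM_coord (by decide),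
    ← lineDerivOp_smulLeftCLM_coord (by decide)]
  simp only [mulCoord, TemperedDistribution.smulLeftCLM_apply_apply,
    TemperedDistribution.lineDerivOp_apply_apply, map_neg]
  ring

/-- The direction is the vector field generating `rot`; this ties the differential operator to the
rotation group. -/
theorem rotDeriv_apply (φ : 𝓢(E3, ℂ)) (x : E3) :
    rotDeriv φ x = fderiv ℝ φ x (x 0 • e3 1 - x 1 • e3 0) := by
  rw [rotDeriv, _root_.sub_apply,
    SchwartzMap.smulLeftCLM_apply_apply (hasTemperateGrowth_coord 0),
    SchwartzMap.smulLeftCLM_apply_apply (hasTemperateGrowth_coord 1),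
    SchwartzMap.lineDerivOp_apply_eq_fderiv, SchwartzMap.lineDerivOp_apply_eq_fderiv,
    map_sub, map_smul, map_smul]
  simp

/-! ### Rotations -/

/-- The rotation by the angle `θ` around the third axis. -/
noncomputable def rot (θ : ℝ) : E3 ≃ₗᵢ[ℝ] E3 where
  toFun x := !₂[Real.cos θ * x 0 - Real.sin θ * x 1, Real.sin θ * x 0 + Real.cos θ * x 1, x 2]
  invFun x := !₂[Real.cos θ * x 0 + Real.sin θ * x 1, -Real.sin θ * x 0 + Real.cos θ * x 1, x 2]
  map_add' x y := by
    ext i; fin_cases i <;> simp <;> ring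
  map_smul' c x := by
    ext i; fin_cases i <;> simp <;> ring
  left_inv x := by
    ext i
    fin_cases i <;> simp
    · linear_combination x 0 * Real.sin_sq_add_cos_sq θ
    · linear_combination x 1 * Real.sin_sq_add_cos_sq θ
  right_inv x := by
    ext i
    fin_cases i <;> simp
    · linear_combination x 0 * Real.sin_sq_add_cos_sq θ
    · linear_combination x 1 * Real.sin_sq_add_cos_sq θ
  norm_map' x := by
    rw [EuclideanSpace.norm_eq, EuclideanSpace.norm_eq]
    congr 1
    simp [Fin.sum_univ_three]
    linear_combination (x 0 ^ 2 + x 1 ^ 2) * Real.sin_sq_add_cos_sq θ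

theorem rot_apply (θ : ℝ) (x : E3) : rot θ x =
    !₂[Real.cos θ * x 0 - Real.sin θ * x 1, Real.sin θ * x 0 + Real.cos θ * x 1, x 2] := rfl

theorem rot_neg_rot (θ : ℝ) (x : E3) : rot (-θ) (rot θ x) = x := by
  rw [rot_apply, rot_apply]
  ext i
  fin_cases i <;> simp
  · linear_combination x 0 * Real.sin_sq_add_cos_sq θ
  · linear_combination x 1 * Real.sin_sq_add_cos_sq θ

theorem hasDerivAt_rot_neg (x : E3) (θ : ℝ) :
    HasDerivAt (fun t => rot (-t) x)
      (-((rot (-θ) x) 0 • e3 1 - (rot (-θ) x) 1 • e3 0)) θ := by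
  have h : ∀ t, rot (-t) x = Real.cos t • (x 0 • e3 0 + x 1 • e3 1)
      + Real.sin t • (x 1 • e3 0 - x 0 • e3 1) + x 2 • e3 2 := by
    intro t
    rw [rot_apply]
    ext i
    fin_cases i <;> simp [e3] <;> ring
  simp only [h]
  convert! (((Real.hasDerivAt_cos θ).smul_const (x 0 • e3 0 + x 1 • e3 1)).add
    ((Real.hasDerivAt_sin θ).smul_const (x 1 • e3 0 - x 0 • e3 1))).add_const (x 2 • e3 2) using 1
  ext i
  fin_cases i <;> simp [e3] <;> ring

theorem hasDerivAt_comp_rot (φ : 𝓢(E3, ℂ)) (x : E3) (θ : ℝ) :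
    HasDerivAt (fun t => φ (rot (-t) x)) (-rotDeriv φ (rot (-θ) x)) θ := by
  have h := (φ.differentiableAt (x := rot (-θ) x)).hasFDerivAt.comp_hasDerivAt θ
    (hasDerivAt_rot_neg x θ)
  rw [rotDeriv_apply, ← map_neg]
  exact h

/-- The bound depends on `‖x‖` only, hence is uniform over rotations, and `(1 + ‖x‖²)⁻¹` is square
integrable on `ℝ³`. It therefore dominates pairings with `L²` functions. -/
theorem exists_schwartz_bound (φ : 𝓢(E3, ℂ)) :
    ∃ C : ℝ, ∀ x, ‖φ x‖ ≤ C * (1 + ‖x‖ ^ 2)⁻¹ := by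
  obtain ⟨C0, -, h0⟩ := φ.decay 0 0
  obtain ⟨C2, -, h2⟩ := φ.decay 2 0
  refine ⟨C0 + C2, fun x => ?_⟩
  have a := h0 x
  have b := h2 x
  simp only [norm_iteratedFDeriv_zero, pow_zero, one_mul] at a b
  rw [← div_eq_mul_inv, le_div_iff₀ (by positivity)]
  linarith

theorem integrable_inv_mul_norm (f : L2R3) :
    Integrable (fun x : E3 => (1 + ‖x‖ ^ 2)⁻¹ * ‖f x‖) := by
  have h1 : MemLp (fun x : E3 => (1 + ‖x‖ ^ 2)⁻¹) 2 := by
    have hc : Continuous fun x : E3 => (1 + ‖x‖ ^ 2)⁻¹ := by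
      have hne : ∀ p : E3, 1 + ‖p‖ ^ 2 ≠ 0 := fun p => by positivity
      fun_prop (disch := exact hne _)
    rw [memLp_two_iff_integrable_sq_norm hc.aestronglyMeasurable]
    have hint : Integrable (fun p : E3 => (1 + ‖p‖ ^ 2) ^ (-(4 : ℝ) / 2)) volume :=
      integrable_rpow_neg_one_add_norm_sq (by simp; norm_num)
    refine hint.congr (Filter.Eventually.of_forall fun p => ?_)
    have hpos : (0 : ℝ) < 1 + ‖p‖ ^ 2 := by positivity
    simp only [norm_inv, Real.norm_of_nonneg hpos.le]
    rw [show (-(4 : ℝ) / 2) = -((2 : ℕ) : ℝ) by norm_num, Real.rpow_neg hpos.le,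
      Real.rpow_natCast, inv_pow]
  exact h1.integrable_mul (Lp.memLp f).norm

/-- A square integrable function that transforms under rotations around the third axis by the
character `e^{ikθ}` is an eigenfunction of `L₃` with eigenvalue `k`. -/
theorem distL3_eq_of_rot_covariant (f : L2R3) (k : ℝ)
    (hf : ∀ θ : ℝ, ∀ᵐ x, f (rot θ x) = Complex.exp (θ * k * Complex.I) * f x) :
    distL3 (f : 𝓢'(E3, ℂ)) = (k : ℂ) • (f : 𝓢'(E3, ℂ)) := by
  ext φ
  rw [distL3_apply]
  change _ = (k : ℂ) * (f : 𝓢'(E3, ℂ)) φ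
  simp only [Lp.toTemperedDistribution_apply, smul_eq_mul]
  obtain ⟨C0, hC0⟩ := exists_schwartz_bound φ
  obtain ⟨C, hC⟩ := exists_schwartz_bound (rotDeriv φ)
  have hfm : AEStronglyMeasurable f volume := (Lp.memLp f).aestronglyMeasurable
  -- The function `θ ↦ ∫ φ(R_{-θ} x) f(x) dx` is differentiated at `0` in two ways: under the
  -- integral sign, which produces `rotDeriv φ`, and after moving the rotation onto `f`, which
  -- produces the character (`hcov`).
  have hder := (hasDerivAt_integral_of_dominated_loc_of_deriv_le (x₀ := (0 : ℝ)) (s := Set.univ)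
    (μ := (volume : Measure E3)) (F := fun θ x => φ (rot (-θ) x) * f x)
    (F' := fun θ x => -rotDeriv φ (rot (-θ) x) * f x)
    (bound := fun x => C * ((1 + ‖x‖ ^ 2)⁻¹ * ‖f x‖)) Filter.univ_mem
    (Filter.Eventually.of_forall fun θ =>
      ((φ.continuous.comp (rot (-θ)).continuous).aestronglyMeasurable).mul hfm)
    (((integrable_inv_mul_norm f).const_mul C0).mono'
      (((φ.continuous.comp (rot (-0)).continuous).aestronglyMeasurable).mul hfm)
      (Filter.Eventually.of_forall fun x => by
        have := hC0 (rot (-0) x)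
        rw [LinearIsometryEquiv.norm_map] at this
        rw [norm_mul, ← mul_assoc]
        gcongr))
    ((((rotDeriv φ).continuous.comp (rot (-0)).continuous).neg.aestronglyMeasurable).mul hfm)
    (Filter.Eventually.of_forall fun x θ _ => by
        have := hC (rot (-θ) x)
        rw [LinearIsometryEquiv.norm_map] at this
        rw [norm_mul, norm_neg, ← mul_assoc]
        gcongr)
    ((integrable_inv_mul_norm f).const_mul C)
    (Filter.Eventually.of_forall fun x θ _ => (hasDerivAt_comp_rot φ x θ).mul_const _)).2
  have hcov : (fun θ : ℝ => ∫ x, φ (rot (-θ) x) * f x)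
      = fun θ : ℝ => Complex.exp (θ * k * Complex.I) * ∫ x, φ x * f x := by
    funext θ
    rw [← ((rot θ).measurePreserving).integral_comp (rot θ).toHomeomorph.measurableEmbedding,
      ← integral_const_mul]
    refine integral_congr_ae ?_
    filter_upwards [hf θ] with x hx
    rw [hx, rot_neg_rot]
    ring
  rw [hcov] at hder
  have hder2 : HasDerivAt (fun θ : ℝ => Complex.exp (θ * k * Complex.I) * ∫ x, φ x * f x)
      ((k * Complex.I) * ∫ x, φ x * f x) 0 := by
    have h1 : HasDerivAt (fun θ : ℝ => Complex.exp (θ * k * Complex.I)) (k * Complex.I) 0 := by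
      have h2 : HasDerivAt (fun θ : ℝ => (θ : ℂ) * k * Complex.I) (k * Complex.I) 0 := by
        simpa using (((Complex.ofRealCLM.hasDerivAt (x := (0 : ℝ))).mul_const (k : ℂ)).mul_const
          Complex.I)
      simpa using h2.cexp
    exact h1.mul_const _
  have key := hder.unique hder2
  have h0 : ∀ x : E3, rot (-0) x = x := fun x => by
    rw [rot_apply]; ext i; fin_cases i <;> simp
  simp only [h0, neg_mul, integral_neg] at key
  linear_combination -Complex.I * key - (k : ℂ) * (∫ x, φ x * f x) * Complex.I_mul_I

/-! ### The surface measure in stereographic coordinates -/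

open Measure in
theorem lintegral_comp_smul_haar {f : E3 → ℝ≥0∞} (hf : Measurable f) {r : ℝ} (hr : 0 < r) :
    ∫⁻ q : E3, f q = ENNReal.ofReal (r ^ 3) * ∫⁻ p : E3, f (r • p) := by
  rw [← lintegral_map hf (measurable_const_smul r), map_addHaar_smul _ hr.ne',
    lintegral_smul_measure, finrank_euclideanSpace_fin, smul_eq_mul, ← mul_assoc,
    ← ENNReal.ofReal_mul (by positivity), abs_of_pos (by positivity),
    mul_inv_cancel₀ (by positivity)]
  simp

theorem lintegral_Ioi_comp_mul (f : ℝ → ℝ≥0∞) {a : ℝ} (ha : 0 < a) :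
    ∫⁻ t in Set.Ioi (0 : ℝ), f t = ∫⁻ r in Set.Ioi (0 : ℝ), ENNReal.ofReal a * f (a * r) := by
  have himg : (fun r : ℝ => a * r) '' Set.Ioi 0 = Set.Ioi 0 := by
    rw [Set.image_mul_left_Ioi ha, mul_zero]
  conv_lhs => rw [← himg]
  rw [lintegral_image_eq_lintegral_abs_deriv_mul (f' := fun _ => a) measurableSet_Ioi
    (fun x _ => by simpa using ((hasDerivAt_id x).const_mul a).hasDerivWithinAt)
    (fun x _ y _ h => mul_left_cancel₀ ha.ne' h), abs_of_pos ha]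

/-- The substitution `y = c / (4 t) - t` maps `(0, ∞)` onto `ℝ`. -/
theorem lintegral_eq_lintegral_Ioi_div_sub (f : ℝ → ℝ≥0∞) {c : ℝ} (hc : 0 < c) :
    ∫⁻ y, f y = ∫⁻ t in Set.Ioi (0 : ℝ),
      ENNReal.ofReal (c / (4 * t ^ 2) + 1) * f (c / (4 * t) - t) := by
  have himg : (fun t : ℝ => c / (4 * t) - t) '' Set.Ioi 0 = Set.univ := by
    refine Set.eq_univ_of_forall fun y => ?_
    have h1 : |y| < √(y ^ 2 + c) := by
      rw [← Real.sqrt_sq_eq_abs]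
      exact Real.sqrt_lt_sqrt (sq_nonneg y) (by linarith)
    have h2 : √(y ^ 2 + c) ^ 2 = y ^ 2 + c := Real.sq_sqrt (by positivity)
    have h3 : 0 < √(y ^ 2 + c) - y := by linarith [le_abs_self y]
    -- The positive root of `4 t² + 4 y t - c = 0`.
    refine ⟨(√(y ^ 2 + c) - y) / 2, half_pos h3, ?_⟩
    simp only
    field_simp
    linear_combination -4 * h2
  have hder : ∀ t ∈ Set.Ioi (0 : ℝ), HasDerivWithinAt (fun t : ℝ => c / (4 * t) - t)
      (-(c / (4 * t ^ 2) + 1)) (Set.Ioi 0) t := by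
    intro t ht
    have ht0 : t ≠ 0 := ne_of_gt ht
    have h := ((((hasDerivAt_inv ht0).const_mul (c / 4))).sub (hasDerivAt_id t)).hasDerivWithinAt
      (s := Set.Ioi 0)
    refine (h.congr_deriv ?_).congr_of_eventuallyEq ?_ ?_
    · field_simp; ring
    · refine Filter.Eventually.of_forall fun s => ?_
      simp only [Pi.sub_apply, id_eq]
      ring
    · simp only [Pi.sub_apply, id_eq]
      ring
  have hinj : Set.InjOn (fun t : ℝ => c / (4 * t) - t) (Set.Ioi 0) := by
    intro s hs t ht h
    have hs0 : 0 < s := hs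
    have ht0 : 0 < t := ht
    simp only at h
    field_simp at h
    have : (s - t) * (c + 4 * s * t) = 0 := by linear_combination -h
    rcases mul_eq_zero.1 this with h' | h'
    · linarith
    · nlinarith [mul_pos hs0 ht0]
  rw [← setLIntegral_univ, ← himg,
    lintegral_image_eq_lintegral_abs_deriv_mul measurableSet_Ioi hder hinj]
  refine setLIntegral_congr_fun measurableSet_Ioi fun t _ => ?_
  rw [abs_neg, abs_of_pos (by positivity)]

/-- The point of `ℝ⁴` with first three coordinates `q` and last coordinate `y`. -/
noncomputable def consLast (y : ℝ) (q : E3) : E4 := !₂[q 0, q 1, q 2, y]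

theorem continuous_consLast : Continuous fun z : ℝ × E3 => consLast z.1 z.2 := by
  unfold consLast
  refine (PiLp.continuous_toLp 2 _).comp (continuous_pi fun i => ?_)
  fin_cases i <;> simp <;> fun_prop

theorem lintegral_E4_eq {F : E4 → ℝ≥0∞} (hF : Measurable F) :
    ∫⁻ x, F x = ∫⁻ q : E3, ∫⁻ y : ℝ, F (consLast y q) := by
  have hF' : Measurable (F ∘ WithLp.toLp 2) := hF.comp (PiLp.continuous_toLp 2 _).measurable
  set G : ℝ × (Fin 3 → ℝ) → ℝ≥0∞ := fun z =>
    (F ∘ WithLp.toLp 2) ((MeasurableEquiv.piFinSuccAbove (fun _ : Fin 4 => ℝ) 3).symm z) with hG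
  have hGm : Measurable G := hF'.comp (MeasurableEquiv.measurable _)
  calc ∫⁻ x, F x = ∫⁻ a, (F ∘ WithLp.toLp 2) a :=
        ((PiLp.volume_preserving_toLp (Fin 4)).lintegral_comp hF).symm
    _ = ∫⁻ z, G z :=
        ((volume_preserving_piFinSuccAbove (fun _ : Fin 4 => ℝ) 3).symm.lintegral_comp hF').symm
    _ = ∫⁻ v : Fin 3 → ℝ, ∫⁻ y : ℝ, G (y, v) := by
        rw [Measure.volume_eq_prod, lintegral_prod_symm _ hGm.aemeasurable]
    _ = ∫⁻ q : E3, ∫⁻ y : ℝ, G (y, WithLp.ofLp q) :=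
        ((PiLp.volume_preserving_ofLp (Fin 3)).lintegral_comp
          (f := fun v => ∫⁻ y : ℝ, G (y, v)) hGm.lintegral_prod_left').symm
    _ = _ := by
        refine lintegral_congr fun q => lintegral_congr fun y => ?_
        simp only [hG, Function.comp_apply]
        congr 1
        ext i
        fin_cases i <;> rfl

theorem consLast_eq_smul_stereo (r : ℝ) (p : E3) :
    consLast ((‖p‖ ^ 2 + 1)⁻¹ * r * (‖p‖ ^ 2 - 1)) ((2 * ((‖p‖ ^ 2 + 1)⁻¹ * r)) • p)
      = r • (stereo p : E4) := by
  ext i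
  fin_cases i <;> simp [consLast, stereo, stereoVec] <;> ring

/-- Polar coordinates with the sphere parametrized stereographically, reached by elementary
substitutions only: with `x = (q, y)`, put `y = ‖q‖²/(4t) - t` for fixed `q`, then `q = 2t p` for
fixed `t`, which gives `y = t(‖p‖² - 1)`, and finally `t = r / (‖p‖² + 1)`. The Jacobians multiply
to `r³ (2 / (‖p‖² + 1))³`. -/
theorem lintegral_E4_stereo {F : E4 → ℝ≥0∞} (hF : Measurable F) :
    ∫⁻ x, F x = ∫⁻ p : E3, ENNReal.ofReal ((2 / (‖p‖ ^ 2 + 1)) ^ 3) *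
      ∫⁻ r in Set.Ioi (0 : ℝ), ENNReal.ofReal (r ^ 3) * F (r • (stereo p : E4)) := by
  have hcl : Measurable fun z : ℝ × E3 => consLast z.1 z.2 := continuous_consLast.measurable
  calc ∫⁻ x, F x = ∫⁻ q : E3, ∫⁻ y : ℝ, F (consLast y q) := lintegral_E4_eq hF
    _ = ∫⁻ q : E3, ∫⁻ t in Set.Ioi (0 : ℝ), ENNReal.ofReal (‖q‖ ^ 2 / (4 * t ^ 2) + 1) *
          F (consLast (‖q‖ ^ 2 / (4 * t) - t) q) := by
        refine lintegral_congr_ae ?_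
        -- The substitution in `y` needs `‖q‖² > 0`; the point `q = 0` is null.
        filter_upwards [compl_mem_ae_iff.2 (measure_singleton (0 : E3))] with q hq
        have hq0 : q ≠ 0 := hq
        exact lintegral_eq_lintegral_Ioi_div_sub (fun y => F (consLast y q)) (by positivity)
    _ = ∫⁻ t in Set.Ioi (0 : ℝ), ∫⁻ q : E3, ENNReal.ofReal (‖q‖ ^ 2 / (4 * t ^ 2) + 1) *
          F (consLast (‖q‖ ^ 2 / (4 * t) - t) q) := by
        refine lintegral_lintegral_swap (Measurable.aemeasurable ?_)
        refine Measurable.mul (by fun_prop) (hF.comp (hcl.comp (f := fun z : E3 × ℝ =>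
          (‖z.1‖ ^ 2 / (4 * z.2) - z.2, z.1)) (by fun_prop)))
    _ = ∫⁻ t in Set.Ioi (0 : ℝ), ∫⁻ p : E3, ENNReal.ofReal (8 * t ^ 3 * (‖p‖ ^ 2 + 1)) *
          F (consLast (t * (‖p‖ ^ 2 - 1)) ((2 * t) • p)) := by
        refine setLIntegral_congr_fun measurableSet_Ioi fun t ht => ?_
        have ht0 : (0 : ℝ) < t := ht
        have hm : Measurable fun q : E3 => ENNReal.ofReal (‖q‖ ^ 2 / (4 * t ^ 2) + 1) *
            F (consLast (‖q‖ ^ 2 / (4 * t) - t) q) :=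
          Measurable.mul (by fun_prop) (hF.comp (hcl.comp (f := fun q : E3 =>
            (‖q‖ ^ 2 / (4 * t) - t, q)) (by fun_prop)))
        rw [lintegral_comp_smul_haar hm (by positivity : 0 < 2 * t),
          ← lintegral_const_mul' _ _ ENNReal.ofReal_ne_top]
        refine lintegral_congr fun p => ?_
        rw [← mul_assoc, ← ENNReal.ofReal_mul (by positivity), norm_smul,
          Real.norm_of_nonneg (by positivity)]
        congr 2
        · field_simp; ring
        · congr 1
          field_simp
          ring
    _ = ∫⁻ p : E3, ∫⁻ t in Set.Ioi (0 : ℝ), ENNReal.ofReal (8 * t ^ 3 * (‖p‖ ^ 2 + 1)) *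
          F (consLast (t * (‖p‖ ^ 2 - 1)) ((2 * t) • p)) := by
        refine lintegral_lintegral_swap (Measurable.aemeasurable ?_)
        refine Measurable.mul (by fun_prop) (hF.comp (hcl.comp (f := fun z : ℝ × E3 =>
          (z.1 * (‖z.2‖ ^ 2 - 1), (2 * z.1) • z.2)) (by fun_prop)))
    _ = _ := by
        refine lintegral_congr fun p => ?_
        rw [lintegral_Ioi_comp_mul _ (a := (‖p‖ ^ 2 + 1)⁻¹) (by positivity),
          ← lintegral_const_mul' _ _ ENNReal.ofReal_ne_top]
        refine setLIntegral_congr_fun measurableSet_Ioi fun r hr => ?_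
        have hr0 : (0 : ℝ) < r := hr
        rw [consLast_eq_smul_stereo, ← mul_assoc, ← mul_assoc, ← ENNReal.ofReal_mul (by positivity),
          ← ENNReal.ofReal_mul (by positivity)]
        congr 2
        field_simp
        norm_num

-- The surface measure of `s` is `4` times the volume of the cone over `s` in the unit ball. In the
-- coordinates of `lintegral_E4_stereo` the radial integral over that cone is `1/4`, which cancels
-- the `4`.
open scoped Pointwise in
theorem surfaceMeasure_apply {s : Set S3} (hs : MeasurableSet s) :
    surfaceMeasure s = ∫⁻ p in stereo ⁻¹' s, ENNReal.ofReal ((2 / (‖p‖ ^ 2 + 1)) ^ 3) := by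
  have hms : Measurable stereo := continuous_stereo.measurable
  have hv : MeasurableSet ((↑) '' s : Set E4) :=
    (MeasurableEmbedding.subtype_coe Metric.isClosed_sphere.measurableSet).measurableSet_image.2 hs
  have hA : Set.Ioo (0 : ℝ) 1 • ((↑) '' s : Set E4)
      = {x : E4 | x ≠ 0 ∧ ‖x‖ < 1 ∧ ‖x‖⁻¹ • x ∈ ((↑) '' s : Set E4)} := by
    ext x
    constructor
    · rintro ⟨r, hr, -, ⟨ω, hω, rfl⟩, rfl⟩
      have hω1 : ‖(ω : E4)‖ = 1 := by simp
      have hr0 : 0 < r := hr.1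
      have hn : ‖r • (ω : E4)‖ = r := by rw [norm_smul, hω1, mul_one, Real.norm_of_nonneg hr0.le]
      refine ⟨?_, ?_, ?_⟩
      · rw [← norm_ne_zero_iff]
        simpa [hn] using hr0.ne'
      · simpa [hn] using hr.2
      · refine ⟨ω, hω, ?_⟩
        simp only [hn]
        rw [smul_smul, inv_mul_cancel₀ hr0.ne', one_smul]
    · rintro ⟨h0, h1, h2⟩
      refine ⟨‖x‖, ⟨norm_pos_iff.2 h0, h1⟩, _, h2, ?_⟩
      simp only
      rw [smul_smul, mul_inv_cancel₀ (norm_ne_zero_iff.2 h0), one_smul]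
  have hAm : MeasurableSet (Set.Ioo (0 : ℝ) 1 • ((↑) '' s : Set E4)) := by
    rw [hA]
    refine (measurableSet_singleton (0 : E4)).compl.inter (MeasurableSet.inter ?_ ?_)
    · exact measurableSet_lt measurable_norm measurable_const
    · exact (measurable_norm.inv.smul measurable_id) hv
  have hmem : ∀ p : E3, ∀ r ∈ Set.Ioi (0 : ℝ),
      (r • (stereo p : E4) ∈ Set.Ioo (0 : ℝ) 1 • ((↑) '' s : Set E4)) ↔ r < 1 ∧ stereo p ∈ s := by
    intro p r hr
    have hr0 : 0 < r := hr
    have hω1 : ‖(stereo p : E4)‖ = 1 := by simp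
    have hn : ‖r • (stereo p : E4)‖ = r := by rw [norm_smul, hω1, mul_one, Real.norm_of_nonneg hr0.le]
    rw [hA, Set.mem_ofPred_eq, hn, smul_smul, inv_mul_cancel₀ hr0.ne', one_smul,
      ← norm_ne_zero_iff, hn]
    simp [hr0.ne']
  have hr3 : ∫⁻ r in Set.Ioo (0 : ℝ) 1, ENNReal.ofReal (r ^ 3) = ENNReal.ofReal (1 / 4) := by
    rw [← ofReal_integral_eq_lintegral_ofReal, ← integral_Ioc_eq_integral_Ioo,
      ← intervalIntegral.integral_of_le zero_le_one]
    · norm_num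
    · exact ((continuous_pow 3).integrableOn_Icc (a := (0 : ℝ)) (b := 1)).mono_set Set.Ioo_subset_Icc_self
    · filter_upwards [ae_restrict_mem measurableSet_Ioo] with r hr
      exact pow_nonneg hr.1.le _
  rw [surfaceMeasure, Measure.toSphere_apply' _ hs]
  generalize Set.Ioo (0 : ℝ) 1 • ((↑) '' s : Set E4) = A at hAm hmem ⊢
  rw [← lintegral_indicator_one hAm,
    lintegral_E4_stereo (measurable_one.indicator hAm), finrank_euclideanSpace_fin]
  have hin : ∀ p : E3, ∫⁻ r in Set.Ioi (0 : ℝ), ENNReal.ofReal (r ^ 3) *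
      A.indicator 1 (r • (stereo p : E4))
        = (stereo ⁻¹' s).indicator (fun _ => ENNReal.ofReal (1 / 4)) p := by
    intro p
    by_cases hp : stereo p ∈ s
    · rw [Set.indicator_of_mem (show p ∈ stereo ⁻¹' s from hp), ← hr3]
      rw [← Set.Ioi_inter_Iio, Set.inter_comm, ← setLIntegral_indicator measurableSet_Iio]
      refine setLIntegral_congr_fun measurableSet_Ioi fun r hr => ?_
      have hind : A.indicator (1 : E4 → ℝ≥0∞) (r • (stereo p : E4)) = if r < 1 then 1 else 0 := by
        classical
        rw [Set.indicator_apply]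
        simp [hmem p r hr, hp]
      rw [hind, Set.indicator_apply]
      simp
    · rw [Set.indicator_of_notMem (show p ∉ stereo ⁻¹' s from hp), setLIntegral_congr_fun
        (g := fun _ => 0) measurableSet_Ioi fun r hr => ?_]
      · simp
      · simp [hmem p r hr, hp]
  simp only [hin]
  rw [← lintegral_const_mul' _ _ (by simp), ← lintegral_indicator (hms hs)]
  refine lintegral_congr fun p => ?_
  by_cases hp : p ∈ stereo ⁻¹' s
  · rw [Set.indicator_of_mem hp, Set.indicator_of_mem hp, mul_comm, mul_assoc,
      show ((4 : ℕ) : ℝ≥0∞) = ENNReal.ofReal 4 by simp, ← ENNReal.ofReal_mul (by norm_num)]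
    norm_num
  · rw [Set.indicator_of_notMem hp, Set.indicator_of_notMem hp, mul_zero, mul_zero]

/-- Stereographic projection has the Jacobian `(2 / (|p|² + 1))³`. -/
theorem surfaceMeasure_eq_map : surfaceMeasure = Measure.map stereo
    ((volume : Measure E3).withDensity fun p => ENNReal.ofReal ((2 / (‖p‖ ^ 2 + 1)) ^ 3)) := by
  ext s hs
  have hms : Measurable stereo := continuous_stereo.measurable
  rw [Measure.map_apply hms hs, withDensity_apply _ (hms hs), surfaceMeasure_apply hs]

theorem integral_surfaceMeasure {f : S3 → ℂ} (hf : Continuous f) :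
    ∫ ω, f ω ∂surfaceMeasure
      = ∫ p : E3, (((2 / (‖p‖ ^ 2 + 1)) ^ 3 : ℝ) : ℂ) * f (stereo p) := by
  rw [surfaceMeasure_eq_map, integral_map continuous_stereo.aemeasurable hf.aestronglyMeasurable,
    integral_withDensity_eq_integral_toReal_smul (by fun_prop) (by simp)]
  refine integral_congr_ae (Filter.Eventually.of_forall fun p => ?_)
  simp only
  rw [ENNReal.toReal_ofReal (by positivity), Complex.real_smul]

open scoped Pointwise in
theorem measurePreserving_neg_surfaceMeasure :
    MeasurePreserving (fun ω : S3 => -ω) surfaceMeasure surfaceMeasure := by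
  refine ⟨measurable_neg, ?_⟩
  ext s hs
  rw [Measure.map_apply measurable_neg hs, surfaceMeasure, Measure.toSphere_apply' _ hs,
    Measure.toSphere_apply' _ (measurable_neg hs)]
  congr 1
  rw [← Measure.measure_neg]
  congr 1
  ext x
  simp only [Set.mem_smul, Set.mem_neg, Set.mem_image, Set.mem_preimage]
  constructor
  · rintro ⟨r, hr, -, ⟨ω, hω, rfl⟩, h⟩
    refine ⟨r, hr, _, ⟨-ω, hω, rfl⟩, ?_⟩
    rw [← neg_eq_iff_eq_neg.2 h.symm.symm]
    simp
  · rintro ⟨r, hr, -, ⟨ω, hω, rfl⟩, h⟩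
    refine ⟨r, hr, _, ⟨-ω, by simpa using hω, rfl⟩, ?_⟩
    rw [← h]
    simp

theorem integral_surfaceMeasure_eq_zero_of_odd {f : S3 → ℂ} (hf : ∀ ω, f (-ω) = -f ω) :
    ∫ ω, f ω ∂surfaceMeasure = 0 := by
  have h := measurePreserving_neg_surfaceMeasure.integral_comp
    (Homeomorph.neg S3).measurableEmbedding f
  simp only [hf, integral_neg] at h
  exact self_eq_neg.1 h.symm

/-! ### Gaussian integrals of products of linear forms -/

theorem hasTemperateGrowth_finset_prod {ι : Type*} (S : Finset ι) {f : ι → E4 → ℂ}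
    (hf : ∀ k ∈ S, (f k).HasTemperateGrowth) : (fun x => ∏ k ∈ S, f k x).HasTemperateGrowth := by
  classical
  induction S using Finset.induction_on with
  | empty => simp
  | insert k S hk ih =>
    simp only [Finset.prod_insert hk]
    exact (hf k (by simp)).mul (ih fun j hj => hf j (by simp [hj]))

/-- The Gaussian `e^{-|x|²/2}` on `ℝ⁴`. -/
noncomputable def gauss (x : E4) : ℝ := Real.exp (-(‖x‖ ^ 2 / 2))

theorem continuous_gauss : Continuous gauss := by
  unfold gauss
  fun_prop

theorem integrable_exp_neg_quarter : Integrable fun x : E4 => Real.exp (-(‖x‖ ^ 2 / 4)) := by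
  have h := (GaussianFourier.integrable_cexp_neg_mul_sq_norm_add (V := E4) (b := 1 / 4)
    (by norm_num) 0 0).norm
  refine h.congr (Filter.Eventually.of_forall fun x => ?_)
  simp only [Complex.norm_exp]
  congr 1
  simp [← Complex.ofReal_pow]
  ring

theorem integrable_mul_gauss {P : E4 → ℂ} (hP : P.HasTemperateGrowth) :
    Integrable fun x => P x * (gauss x : ℂ) := by
  obtain ⟨k, C, hC⟩ := hP.2 0
  simp only [norm_iteratedFDeriv_zero] at hC
  have hC0 : 0 ≤ C := by simpa using (norm_nonneg _).trans (hC 0)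
  refine (integrable_exp_neg_quarter.const_mul (C * k.factorial * Real.exp 2)).mono'
    ((hP.1.continuous.mul (Complex.continuous_ofReal.comp continuous_gauss)).aestronglyMeasurable)
    (Filter.Eventually.of_forall fun x => ?_)
  have h1 : (1 + ‖x‖) ^ k ≤ k.factorial * Real.exp (1 + ‖x‖) := by
    have := Real.pow_div_factorial_le_exp (1 + ‖x‖) (by positivity) k
    rw [div_le_iff₀ (by positivity)] at this
    linarith
  -- Completing the square: `1 + ‖x‖ - ‖x‖²/2 ≤ 2 - ‖x‖²/4`.
  have h2 : Real.exp (1 + ‖x‖) * gauss x ≤ Real.exp 2 * Real.exp (-(‖x‖ ^ 2 / 4)) := by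
    rw [gauss, ← Real.exp_add, ← Real.exp_add, Real.exp_le_exp]
    nlinarith [sq_nonneg (‖x‖ / 2 - 1)]
  have hg : 0 ≤ gauss x := (Real.exp_pos _).le
  rw [norm_mul, Complex.norm_real, Real.norm_of_nonneg hg]
  calc ‖P x‖ * gauss x ≤ C * (k.factorial * Real.exp (1 + ‖x‖)) * gauss x := by
        gcongr
        exact (hC x).trans (by gcongr)
    _ = C * k.factorial * (Real.exp (1 + ‖x‖) * gauss x) := by ring
    _ ≤ C * k.factorial * (Real.exp 2 * Real.exp (-(‖x‖ ^ 2 / 4))) := by gcongr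
    _ = _ := by ring

theorem hasLineDerivAt_gauss (x v : E4) :
    HasLineDerivAt ℝ (fun x => (gauss x : ℂ)) (-((inner ℝ x v : ℝ) : ℂ) * gauss x) x v := by
  have h : HasDerivAt (fun t : ℝ => gauss (x + t • v)) (-(inner ℝ x v) * gauss x) 0 := by
    have h1 : HasDerivAt (fun t : ℝ => x + t • v) v 0 := by
      simpa using ((hasDerivAt_id (0 : ℝ)).smul_const v).const_add x
    have h2 := ((h1.norm_sq.div_const 2).neg).exp
    refine h2.congr_deriv ?_
    simp only [Pi.neg_apply, zero_smul, add_zero, gauss]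
    ring
  have := h.ofReal_comp
  simpa [HasLineDerivAt] using this

/-- Integration by parts against the Gaussian. -/
theorem integral_inner_mul_gauss {P P' : E4 → ℂ} (hP : P.HasTemperateGrowth)
    (hP' : P'.HasTemperateGrowth) (v : E4) (h : ∀ x, HasLineDerivAt ℝ P (P' x) x v) :
    ∫ x, ((inner ℝ x v : ℝ) : ℂ) * P x * gauss x = ∫ x, P' x * gauss x := by
  have hvP : (fun x : E4 => ((inner ℝ x v : ℝ) : ℂ) * P x).HasTemperateGrowth := by fun_prop
  have key := integral_bilinear_hasLineDerivAt_right_eq_neg_left_of_integrable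
    (μ := (volume : Measure E4)) (f := P) (f' := P') (g := fun x => (gauss x : ℂ))
    (g' := fun x => -((inner ℝ x v : ℝ) : ℂ) * gauss x) (v := v)
    (B := ContinuousLinearMap.mul ℝ ℂ) (integrable_mul_gauss hP')
    ((integrable_mul_gauss hvP).neg.congr (Filter.Eventually.of_forall fun x => by
      simp; ring)) (integrable_mul_gauss hP) (fun x _ => h x)
    (fun x _ => hasLineDerivAt_gauss x v)
  simp only [ContinuousLinearMap.mul_apply'] at key
  rw [← neg_inj, ← key, ← integral_neg]
  refine integral_congr_ae (Filter.Eventually.of_forall fun x => ?_)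
  simp only
  ring

/-- The complex linear form with coefficients `a` on `ℝ⁴`. -/
noncomputable def linC (a : Fin 4 → ℂ) (x : E4) : ℂ := ∑ i, a i * ((x i : ℝ) : ℂ)

theorem hasTemperateGrowth_linC (a : Fin 4 → ℂ) : (linC a).HasTemperateGrowth := by
  have h : linC a = fun x => ∑ i, a i * ((inner ℝ x (EuclideanSpace.single i (1 : ℝ)) : ℝ) : ℂ) := by
    funext x
    simp [linC, EuclideanSpace.inner_single_right]
  rw [h]
  fun_prop

/-- Integration by parts in each coordinate trades a linear factor `a · x` for the derivative `a ·
∇`; the pairing is bilinear, without conjugation. -/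
theorem integral_linC_mul_gauss {P : E4 → ℂ} {D : Fin 4 → E4 → ℂ} (hP : P.HasTemperateGrowth)
    (hD : ∀ i, (D i).HasTemperateGrowth)
    (h : ∀ i x, HasLineDerivAt ℝ P (D i x) x (EuclideanSpace.single i (1 : ℝ))) (a : Fin 4 → ℂ) :
    ∫ x, linC a x * P x * gauss x = ∫ x, (∑ i, a i * D i x) * gauss x := by
  have h1 : ∀ x, linC a x * P x * gauss x = ∑ i, a i *
      (((inner ℝ x (EuclideanSpace.single i (1 : ℝ)) : ℝ) : ℂ) * P x * gauss x) := by
    intro x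
    simp only [linC, EuclideanSpace.inner_single_right, Finset.sum_mul]
    exact Finset.sum_congr rfl fun i _ => by simp; ring
  have h2 : ∀ x, (∑ i, a i * D i x) * (gauss x : ℂ) = ∑ i, a i * (D i x * gauss x) := by
    intro x
    rw [Finset.sum_mul]
    exact Finset.sum_congr rfl fun i _ => by ring
  simp only [h1, h2]
  rw [integral_finsetSum, integral_finsetSum]
  · refine Finset.sum_congr rfl fun i _ => ?_
    rw [integral_const_mul, integral_const_mul, integral_inner_mul_gauss hP (hD i) _ (h i)]
  · exact fun i _ => (integrable_mul_gauss (hD i)).const_mul _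
  · intro i _
    refine (integrable_mul_gauss ?_).const_mul _
    fun_prop

theorem hasDerivAt_linC (a : Fin 4 → ℂ) (x : E4) (i : Fin 4) :
    HasDerivAt (fun t : ℝ => linC a (x + t • EuclideanSpace.single i (1 : ℝ))) (a i) 0 := by
  have h : (fun t : ℝ => linC a (x + t • EuclideanSpace.single i (1 : ℝ)))
      = fun t : ℝ => linC a x + (t : ℂ) * a i := by
    funext t
    simp only [linC, PiLp.add_apply, PiLp.smul_apply, PiLp.single_apply, smul_eq_mul,
      Complex.ofReal_add, mul_add, Finset.sum_add_distrib, mul_ite, mul_one, mul_zero,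
      apply_ite Complex.ofReal, Complex.ofReal_zero, Finset.sum_ite_eq',
      Finset.mem_univ, if_true, mul_comm (t : ℂ)]
  rw [h]
  simpa using ((Complex.ofRealCLM.hasDerivAt (x := (0 : ℝ))).mul_const (a i)).const_add (linC a x)

/-- The Gaussian pairing of the power of an isotropic linear form with a product of linear forms. -/
theorem integral_linC_pow_mul_prod_gauss {ι : Type*} [DecidableEq ι] {a : Fin 4 → ℂ}
    (ha : ∑ i, a i * a i = 0) (b : ι → Fin 4 → ℂ) (n : ℕ) (S : Finset ι) (hS : S.card = n) :
    ∫ x, linC a x ^ n * (∏ k ∈ S, linC (b k) x) * gauss x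
      = n.factorial * (∏ k ∈ S, ∑ i, a i * b k i) * ∫ x, (gauss x : ℂ) := by
  have htg := hasTemperateGrowth_linC
  have hprod : ∀ T : Finset ι, (fun x => ∏ k ∈ T, linC (b k) x).HasTemperateGrowth :=
    fun T => hasTemperateGrowth_finset_prod T fun k _ => htg _
  induction n generalizing S with
  | zero =>
    obtain rfl := Finset.card_eq_zero.1 hS
    simp
  | succ n ih =>
    set P : E4 → ℂ := fun x => linC a x ^ n * ∏ k ∈ S, linC (b k) x with hP
    set D : Fin 4 → E4 → ℂ := fun i x => n * linC a x ^ (n - 1) * a i * ∏ k ∈ S, linC (b k) x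
      + linC a x ^ n * ∑ k ∈ S, (∏ j ∈ S.erase k, linC (b j) x) * b k i with hD
    have hPt : P.HasTemperateGrowth := ((htg a).pow n).mul (hprod S)
    have hDt : ∀ i, (D i).HasTemperateGrowth := by
      intro i
      refine Function.HasTemperateGrowth.add ?_ ?_
      · exact (((Function.HasTemperateGrowth.const _).mul ((htg a).pow _)).mul
          (Function.HasTemperateGrowth.const _)).mul (hprod S)
      · exact ((htg a).pow n).mul (Function.HasTemperateGrowth.sum fun k _ =>
          (hprod _).mul (Function.HasTemperateGrowth.const _))
    have hder : ∀ i x, HasLineDerivAt ℝ P (D i x) x (EuclideanSpace.single i (1 : ℝ)) := by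
      intro i x
      have h1 := (hasDerivAt_linC a x i).pow n
      have h2 := HasDerivAt.fun_finsetProd (u := S) fun k (_ : k ∈ S) => hasDerivAt_linC (b k) x i
      have h3 := h1.mul h2
      simp only [Pi.pow_apply, zero_smul, add_zero, smul_eq_mul] at h3
      exact h3
    -- The derivative `a · ∇` of `(a · x)^n` is a multiple of `∑ i, a i * a i = 0`, so only the
    -- terms hitting one of the other factors survive.
    have hsum : ∀ x, ∑ i, a i * D i x
        = ∑ k ∈ S, (∑ i, a i * b k i) * (linC a x ^ n * ∏ j ∈ S.erase k, linC (b j) x) := by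
      intro x
      calc ∑ i, a i * D i x = (∑ i, a i * a i) * (n * linC a x ^ (n - 1) * ∏ k ∈ S, linC (b k) x)
            + ∑ i, ∑ k ∈ S, a i * b k i * (linC a x ^ n * ∏ j ∈ S.erase k, linC (b j) x) := by
            rw [Finset.sum_mul, ← Finset.sum_add_distrib]
            refine Finset.sum_congr rfl fun i _ => ?_
            rw [hD]
            simp only [Finset.mul_sum, mul_add]
            congr 1
            · ring
            · exact Finset.sum_congr rfl fun k _ => by ring
        _ = _ := by
            rw [ha, zero_mul, zero_add, Finset.sum_comm]
            exact Finset.sum_congr rfl fun k _ => by rw [Finset.sum_mul]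
    calc ∫ x, linC a x ^ (n + 1) * (∏ k ∈ S, linC (b k) x) * gauss x
        = ∫ x, linC a x * P x * gauss x := by
          congr 1; funext x; rw [hP]; ring
      _ = ∫ x, ∑ k ∈ S, (∑ i, a i * b k i) *
            (linC a x ^ n * (∏ j ∈ S.erase k, linC (b j) x) * gauss x) := by
          rw [integral_linC_mul_gauss hPt hDt hder]
          congr 1; funext x
          rw [hsum, Finset.sum_mul]
          exact Finset.sum_congr rfl fun k _ => by ring
      _ = ∑ k ∈ S, (∑ i, a i * b k i) *
            (n.factorial * (∏ j ∈ S.erase k, ∑ i, a i * b j i) * ∫ x, (gauss x : ℂ)) := by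
          rw [integral_finsetSum]
          · refine Finset.sum_congr rfl fun k hk => ?_
            rw [integral_const_mul, ih _ (by rw [Finset.card_erase_of_mem hk, hS]; rfl)]
          · intro k _
            exact (integrable_mul_gauss (((htg a).pow n).mul (hprod _))).const_mul _
      -- Whichever factor is differentiated, the same full product results; the `n + 1` choices turn
      -- `n!` into `(n + 1)!`.
      _ = ∑ k ∈ S, n.factorial * (∏ j ∈ S, ∑ i, a i * b j i) * ∫ x, (gauss x : ℂ) := by
          refine Finset.sum_congr rfl fun k hk => ?_
          rw [← Finset.mul_prod_erase S _ hk]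
          ring
      _ = _ := by
          rw [Finset.sum_const, hS, Nat.factorial_succ, nsmul_eq_mul]
          push_cast
          ring

theorem integral_gauss_pos : 0 < ∫ x : E4, gauss x := by
  have hint : Integrable gauss := by
    have h := (integrable_mul_gauss (P := fun _ => 1) (by simp)).norm
    refine h.congr (Filter.Eventually.of_forall fun x => ?_)
    simp only [one_mul]
    rw [Complex.norm_real, Real.norm_of_nonneg (show 0 ≤ gauss x from (Real.exp_pos _).le)]
  exact integral_pos_of_integrable_nonneg_nonzero (x := 0) continuous_gauss hint
    (fun x => (Real.exp_pos _).le) (Real.exp_pos _).ne'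

/-- Polar coordinates for the Gaussian integral of a homogeneous function. -/
theorem integral_homogeneous_mul_gauss {f : E4 → ℂ} {k : ℕ}
    (hf : ∀ (r : ℝ) (x : E4), f (r • x) = (r : ℂ) ^ k * f x) :
    ∫ x, f x * gauss x = (∫ ω : S3, f ω ∂surfaceMeasure) *
      ∫ r : Set.Ioi (0 : ℝ), ((r : ℝ) : ℂ) ^ k * (Real.exp (-((r : ℝ) ^ 2 / 2)) : ℂ)
        ∂(Measure.volumeIoiPow 3) := by
  have h := (volume : Measure E4).measurePreserving_homeomorphUnitSphereProd.integral_comp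
    (Homeomorph.measurableEmbedding _) (fun z : S3 × Set.Ioi (0 : ℝ) =>
      f z.1 * (((z.2 : ℝ) : ℂ) ^ k * (Real.exp (-((z.2 : ℝ) ^ 2 / 2)) : ℂ)))
  rw [finrank_euclideanSpace_fin] at h
  have hp := integral_prod_mul (μ := (volume : Measure E4).toSphere)
    (ν := Measure.volumeIoiPow (4 - 1)) (fun ω : S3 => f ω) (fun r : Set.Ioi (0 : ℝ) =>
      ((r : ℝ) : ℂ) ^ k * (Real.exp (-((r : ℝ) ^ 2 / 2)) : ℂ))
  refine Eq.trans ?_ (h.trans hp)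
  have hsub := integral_subtype_comap (μ := (volume : Measure E4))
    (measurableSet_singleton (0 : E4)).compl (fun x => f x * (gauss x : ℂ))
  rw [restrict_compl_singleton] at hsub
  rw [← hsub]
  refine integral_congr_ae (Filter.Eventually.of_forall fun x => ?_)
  have hx : (x : E4) = ‖(x : E4)‖ • ((homeomorphUnitSphereProd E4 x).1 : E4) := by
    have h0 : ‖(x : E4)‖ ≠ 0 := norm_ne_zero_iff.2 x.2
    simp [smul_smul, h0]
  have hfx : f x = (‖(x : E4)‖ : ℂ) ^ k * f (homeomorphUnitSphereProd E4 x).1 := by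
    rw [← hf, ← hx]
  simp only [homeomorphUnitSphereProd_apply_snd_coe]
  rw [hfx, gauss]
  ring

/-! ### Powers of unbounded operators on eigenvectors -/

section Powers

variable {H : Type*} [AddCommGroup H] [Module ℂ H]

/-- Phrasing the calculus in terms of graphs carries domain membership and value together. -/
theorem mem_graph_opComp {S T : H →ₗ.[ℂ] H} {f g h : H} (hT : (f, g) ∈ T.graph)
    (hS : (g, h) ∈ S.graph) : (f, h) ∈ (opComp S T).graph := by
  rw [LinearPMap.mem_graph_iff] at hT hS ⊢
  obtain ⟨⟨f', hf'⟩, rfl, rfl⟩ := hT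
  obtain ⟨⟨g', hg'⟩, hg, rfl⟩ := hS
  simp only at hg
  subst hg
  exact ⟨⟨f', ⟨⟨f', hf'⟩, hg', rfl⟩⟩, rfl, rfl⟩

theorem mem_graph_opPow {T : H →ₗ.[ℂ] H} {f : H} {μ : ℂ} (hT : (f, μ • f) ∈ T.graph) (m : ℕ) :
    (f, μ ^ m • f) ∈ (opPow T m).graph := by
  induction m with
  | zero =>
    rw [LinearPMap.mem_graph_iff]
    exact ⟨⟨f, trivial⟩, rfl, by simp [opPow]⟩
  | succ m ih =>
    refine mem_graph_opComp ih ?_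
    have := T.graph.smul_mem (μ ^ m) hT
    rwa [Prod.smul_mk, smul_smul, ← pow_succ] at this

theorem mem_graph_smul {T : H →ₗ.[ℂ] H} {f g : H} (c : ℂ) (hT : (f, g) ∈ T.graph) :
    (f, c • g) ∈ (c • T).graph := by
  rw [LinearPMap.mem_graph_iff] at hT ⊢
  obtain ⟨y, rfl, rfl⟩ := hT
  exact ⟨y, rfl, rfl⟩

end Powers

/-! ### Configuration space states of functions on the sphere -/

theorem opJhalf_opK_eq (f : S3 → ℂ) : opJhalf (opK f) =
    fun p => (((2 / (‖p‖ ^ 2 + 1)) ^ 2 : ℝ) : ℂ) * f (stereo p) :=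
  funext fun p => opJhalf_opK f p

theorem continuous_stereoFactor : Continuous fun p : E3 => 2 / (‖p‖ ^ 2 + 1) := by
  have hne : ∀ p : E3, ‖p‖ ^ 2 + 1 ≠ 0 := fun p => by positivity
  fun_prop (disch := exact hne _)

theorem memLp_opJhalf_opK_continuousMap (f : C(S3, ℂ)) :
    MemLp (opJhalf (opK f)) 2 (volume : Measure E3) := by
  have h1 : MemLp (fun p : E3 => (2 / (‖p‖ ^ 2 + 1)) ^ 2) 2 (volume : Measure E3) := by
    have hc : Continuous fun p : E3 => (2 / (‖p‖ ^ 2 + 1)) ^ 2 := continuous_stereoFactor.pow 2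
    rw [memLp_two_iff_integrable_sq_norm hc.aestronglyMeasurable]
    have hint : Integrable (fun p : E3 => (1 + ‖p‖ ^ 2) ^ (-(8 : ℝ) / 2)) volume :=
      integrable_rpow_neg_one_add_norm_sq (by simp; norm_num)
    refine (hint.const_mul 16).congr (Filter.Eventually.of_forall fun p => ?_)
    have hpos : (0 : ℝ) < 1 + ‖p‖ ^ 2 := by positivity
    simp only
    rw [show (-(8 : ℝ) / 2) = -((4 : ℕ) : ℝ) by norm_num, Real.rpow_neg hpos.le,
      Real.rpow_natCast, Real.norm_of_nonneg (by positivity), add_comm (‖p‖ ^ 2) 1]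
    field_simp
    norm_num
  refine h1.of_le_mul (c := ‖f‖) ?_ (Filter.Eventually.of_forall fun p => ?_)
  · rw [opJhalf_opK_eq]
    exact ((Complex.continuous_ofReal.comp (continuous_stereoFactor.pow 2)).mul
      (f.continuous.comp continuous_stereo)).aestronglyMeasurable
  · rw [opJhalf_opK, norm_mul, Complex.norm_real, mul_comm]
    gcongr
    exact f.norm_coe_le_norm _

/-- The momentum space representative, in the normalization of Mathlib's Fourier transform, of the
state obtained from a function on the sphere. -/
noncomputable def momentumFun (r : ℝ) (f : S3 → ℂ) : E3 → ℂ :=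
  dilation (2 * Real.pi) (dilation r (opJhalf (opK f)))

theorem memLp_momentumFun {r : ℝ} (hr : r ≠ 0) (f : C(S3, ℂ)) :
    MemLp (momentumFun r f) 2 (volume : Measure E3) :=
  memLp_dilation (by positivity) (memLp_dilation hr (memLp_opJhalf_opK_continuousMap f))

/-- The map `f ↦ ℱ⁻¹ D_r J^{1/2} K f`. -/
noncomputable def sphereState (r : ℝ) (hr : r ≠ 0) : C(S3, ℂ) →ₗ[ℂ] L2R3 where
  toFun f := 𝓕⁻ ((memLp_momentumFun hr f).toLp (momentumFun r f))
  map_add' f g := by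
    rw [← FourierTransform.fourierInv_add, ← MemLp.toLp_add]
    congr 1
    refine MemLp.toLp_congr _ _ (Filter.Eventually.of_forall fun p => ?_)
    simp [momentumFun, dilation, opJhalf, opK]
    ring
  map_smul' c f := by
    rw [RingHom.id_apply, ← FourierTransform.fourierInv_smul, ← MemLp.toLp_const_smul]
    congr 1
    refine MemLp.toLp_congr _ _ (Filter.Eventually.of_forall fun p => ?_)
    simp [momentumFun, dilation, opJhalf, opK]
    ring

theorem sphereState_apply (r : ℝ) (hr : r ≠ 0) (f : C(S3, ℂ)) :
    sphereState r hr f = 𝓕⁻ ((memLp_momentumFun hr f).toLp (momentumFun r f)) := rfl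

theorem integral_conj_dilation_mul {r : ℝ} (hr : 0 < r) (u v : E3 → ℂ) :
    ∫ x, (starRingEnd ℂ) (dilation r u x) * dilation r v x
      = ∫ x, (starRingEnd ℂ) (u x) * v x := by
  have h : ∀ x, (starRingEnd ℂ) (dilation r u x) * dilation r v x
      = ((r ^ 3 : ℝ) : ℂ) * ((starRingEnd ℂ) (u (r • x)) * v (r • x)) := by
    intro x
    have h3 : (r ^ 3 : ℝ) = r ^ (3 / 2 : ℝ) * r ^ (3 / 2 : ℝ) := by
      rw [← Real.rpow_add hr, ← Real.rpow_natCast]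
      norm_num
    rw [h3, dilation, dilation, map_mul, Complex.conj_ofReal, Complex.ofReal_mul]
    ring
  simp only [h]
  rw [integral_const_mul, Measure.integral_comp_smul volume
    (fun x => (starRingEnd ℂ) (u x) * v x) r, finrank_euclideanSpace_fin, abs_of_pos (by positivity),
    Complex.real_smul, ← mul_assoc, ← Complex.ofReal_mul, mul_inv_cancel₀ (by positivity)]
  simp

/-- The states `ℱ⁻¹ D_r J^{1/2} K f` have the inner product of `L²((1 - ω₄) dΩ)`. -/
theorem inner_sphereState {r : ℝ} (hr : 0 < r) (f g : C(S3, ℂ)) :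
    inner ℂ (sphereState r hr.ne' f) (sphereState r hr.ne' g)
      = ∫ ω : S3, ((1 - ω.1 3 : ℝ) : ℂ) * ((starRingEnd ℂ) (f ω) * g ω) ∂surfaceMeasure := by
  rw [sphereState_apply, sphereState_apply, ← Lp.inner_fourier_eq,
    FourierTransform.fourier_fourierInv_eq, FourierTransform.fourier_fourierInv_eq, L2.inner_def]
  have h1 : ∀ᵐ p : E3, inner ℂ ((memLp_momentumFun hr.ne' f).toLp (momentumFun r f) p)
      ((memLp_momentumFun hr.ne' g).toLp (momentumFun r g) p)
        = (starRingEnd ℂ) (momentumFun r f p) * momentumFun r g p := by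
    filter_upwards [(memLp_momentumFun hr.ne' f).coeFn_toLp,
      (memLp_momentumFun hr.ne' g).coeFn_toLp] with p hf hg
    rw [hf, hg, RCLike.inner_apply, mul_comm]
  rw [integral_congr_ae h1]
  simp only [momentumFun]
  rw [integral_conj_dilation_mul (by positivity), integral_conj_dilation_mul hr,
    integral_surfaceMeasure (by fun_prop)]
  refine integral_congr_ae (Filter.Eventually.of_forall fun p => ?_)
  -- Two factors `J^{1/2} K` contribute the fourth power of `2 / (‖p‖² + 1)`. The Jacobian accounts
  -- for the cube, and the remaining power is the weight `1 - ω₄`.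
  have hw : 1 - (stereo p).1 3 = 2 / (‖p‖ ^ 2 + 1) := by
    have hne : ‖p‖ ^ 2 + 1 ≠ 0 := by positivity
    simp [stereo, stereoVec]
    field_simp
    ring
  simp only [opJhalf_opK]
  rw [hw, map_mul, Complex.conj_ofReal]
  push_cast
  ring

theorem momentumFun_rot (r : ℝ) {f : S3 → ℂ} {k : ℝ}
    (hf : ∀ (θ : ℝ) (p : E3), f (stereo (rot θ p)) = Complex.exp (θ * k * Complex.I) * f (stereo p))
    (θ : ℝ) (p : E3) :
    momentumFun r f (rot θ p) = Complex.exp (θ * k * Complex.I) * momentumFun r f p := by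
  simp only [momentumFun, dilation, opJhalf_opK, ← map_smul, hf, LinearIsometryEquiv.norm_map]
  ring

/-- The momentum function is built from `f ∘ stereo` by radial factors and dilations, so it inherits
the character of `f` and is an eigenfunction of `L₃`. The inverse Fourier transform commutes with
`L₃`. -/
theorem mem_graph_L3_sphereState {r : ℝ} (hr : r ≠ 0) {f : C(S3, ℂ)} {k : ℝ}
    (hf : ∀ (θ : ℝ) (p : E3),
      f (stereo (rot θ p)) = Complex.exp (θ * k * Complex.I) * f (stereo p)) :
    (sphereState r hr f, (k : ℂ) • sphereState r hr f) ∈ L3.graph := by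
  rw [mem_graph_L3_iff, sphereState_apply, ← Lp.toTemperedDistributionCLM_apply (_ • _), map_smul,
    Lp.toTemperedDistributionCLM_apply, ← Lp.fourierInv_toTemperedDistribution_eq,
    distL3_fourierInv, distL3_eq_of_rot_covariant _ k, FourierTransform.fourierInv_smul]
  intro θ
  have hae := (memLp_momentumFun hr f).coeFn_toLp
  filter_upwards [hae, (rot θ).measurePreserving.quasiMeasurePreserving.ae hae] with p h1 h2
  rw [h1, h2, momentumFun_rot r hf]

/-! ### Decomposition of the coherent states into eigenfunctions -/

/-- A complex linear form restricted to the sphere. -/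
noncomputable def linS (a : Fin 4 → ℂ) : C(S3, ℂ) where
  toFun ω := linC a ω
  continuous_toFun := (hasTemperateGrowth_linC a).1.continuous.comp continuous_subtype_val

theorem linS_apply (a : Fin 4 → ℂ) (ω : S3) : linS a ω = linC a ω := rfl

/-- The components of `α` in the eigenspaces of the infinitesimal rotation. -/
noncomputable def eigComp (α : Fin 4 → ℂ) : Fin 3 → Fin 4 → ℂ :=
  ![![(α 0 - Complex.I * α 1) / 2, Complex.I * (α 0 - Complex.I * α 1) / 2, 0, 0],
    ![(α 0 + Complex.I * α 1) / 2, -Complex.I * (α 0 + Complex.I * α 1) / 2, 0, 0],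
    ![0, 0, α 2, α 3]]

/-- The eigenvalues of the infinitesimal rotation. -/
def eigVal : Fin 3 → ℝ := ![1, -1, 0]

/-- The weights of the components of `α`. -/
noncomputable def eigWeight (α : Fin 4 → ℂ) : Fin 3 → ℝ :=
  ![‖α 0 - Complex.I * α 1‖ ^ 2 / 4, ‖α 0 + Complex.I * α 1‖ ^ 2 / 4,
    (‖α 2‖ ^ 2 + ‖α 3‖ ^ 2) / 2]

theorem sum_eigComp (α : Fin 4 → ℂ) : ∑ a, linS (eigComp α a) = linS α := by
  ext ω
  simp only [Fin.sum_univ_three, ContinuousMap.add_apply, linS_apply, linC, Fin.sum_univ_four,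
    eigComp]
  simp
  linear_combination (-(α 1 * ((ω.1 1 : ℝ) : ℂ))) * Complex.I_sq

/-- Under `stereo`, `rot θ` becomes the rotation of the first two coordinates of `ℝ⁴`. The three
components are multiples of `x₁ + i x₂`, of `x₁ - i x₂`, and a form in the two fixed coordinates. -/
theorem linC_eigComp_stereo_rot (α : Fin 4 → ℂ) (a : Fin 3) (θ : ℝ) (p : E3) :
    linC (eigComp α a) (stereo (rot θ p))
      = Complex.exp (θ * eigVal a * Complex.I) * linC (eigComp α a) (stereo p) := by
  have hn : ‖rot θ p‖ = ‖p‖ := LinearIsometryEquiv.norm_map _ _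
  rw [Complex.exp_mul_I]
  simp only [linC, Fin.sum_univ_four, stereo, stereoVec, hn]
  rw [rot_apply]
  fin_cases a
  · simp [eigComp, eigVal]
    generalize (2 / ((‖p‖ : ℂ) ^ 2 + 1)) = w
    linear_combination (-(w * (α 0 - Complex.I * α 1) / 2 * (p 1) * Complex.sin θ)) * Complex.I_sq
  · simp [eigComp, eigVal]
    generalize (2 / ((‖p‖ : ℂ) ^ 2 + 1)) = w
    linear_combination (-(w * (α 0 + Complex.I * α 1) / 2 * (p 1) * Complex.sin θ)) * Complex.I_sq
  · simp [eigComp, eigVal]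

/-- The components are mutually orthogonal, so this is the squared norm of one of them. The factor
`2` is the squared norm of `α` on `paramSet`, which makes the weights probabilities there. -/
theorem sum_conj_mul_eigComp (α : Fin 4 → ℂ) (a : Fin 3) :
    ∑ i, (starRingEnd ℂ) (α i) * eigComp α a i = 2 * (eigWeight α a : ℂ) := by
  have hz : ∀ z : ℂ, ((‖z‖ : ℂ)) ^ 2 = (starRingEnd ℂ) z * z := fun z => by
    rw [← Complex.conj_mul']
  fin_cases a
  · simp [Fin.sum_univ_four, eigComp, eigWeight, hz]
    ring
  · simp [Fin.sum_univ_four, eigComp, eigWeight, hz]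
    ring
  · simp [Fin.sum_univ_four, eigComp, eigWeight, hz]
    ring

theorem eigWeight_nonneg (α : Fin 4 → ℂ) (a : Fin 3) : 0 ≤ eigWeight α a := by
  fin_cases a <;> simp [eigWeight] <;> positivity

theorem sum_eigWeight {α : Fin 4 → ℂ} (hα : α ∈ paramSet) : ∑ a, eigWeight α a = 1 := by
  obtain ⟨h1, h2, -⟩ := hα
  rw [Fin.sum_univ_four] at h1 h2
  simp [Fin.sum_univ_three, eigWeight, ← Complex.normSq_eq_norm_sq, Complex.normSq_apply]
  linear_combination h1 / 2 + h2 / 2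

/-- The difference of the two squared norms is `4 Im (conj α₁ · α₂)`, with coordinates numbered from
`1`. -/
theorem sum_eigWeight_mul_eigVal (α : Fin 4 → ℂ) : ∑ a, eigWeight α a * eigVal a = ell3 α := by
  simp [Fin.sum_univ_three, eigWeight, eigVal, ell3, ← Complex.normSq_eq_norm_sq,
    Complex.normSq_apply]
  ring

theorem abs_eigVal_le (a : Fin 3) : |eigVal a| ≤ 1 := by
  fin_cases a <;> simp [eigVal]

/-- The isotropy required by the Gaussian pairing. It is where `|Re α| = |Im α|` and the
orthogonality of real and imaginary parts enter. -/
theorem sum_sq_eq_zero {α : Fin 4 → ℂ} (hα : α ∈ paramSet) :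
    ∑ i, (starRingEnd ℂ) (α i) * (starRingEnd ℂ) (α i) = 0 := by
  obtain ⟨h1, h2, h3⟩ := hα
  rw [Fin.sum_univ_four] at h1 h2 h3
  rw [Fin.sum_univ_four]
  apply Complex.ext
  · simp
    linear_combination h1 - h2
  · simp
    linear_combination -2 * h3

theorem sum_conj_mul_self {α : Fin 4 → ℂ} (hα : α ∈ paramSet) :
    ∑ i, (starRingEnd ℂ) (α i) * α i = 2 := by
  obtain ⟨h1, h2, h3⟩ := hα
  rw [Fin.sum_univ_four] at h1 h2 h3
  rw [Fin.sum_univ_four]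
  apply Complex.ext
  · simp
    linear_combination h1 + h2
  · simp
    ring

theorem conj_linC (a : Fin 4 → ℂ) (x : E4) :
    (starRingEnd ℂ) (linC a x) = linC (fun i => (starRingEnd ℂ) (a i)) x := by
  simp [linC]

theorem linC_smul (a : Fin 4 → ℂ) (r : ℝ) (x : E4) : linC a (r • x) = (r : ℂ) * linC a x := by
  simp only [linC, Finset.mul_sum]
  exact Finset.sum_congr rfl fun i _ => by simp; ring

/-- Up to a common factor, the inner products in `L²(𝕊³)` of `(α · ω)^N` with products of linear
forms are the products of the Hermitian products with `α`. -/
theorem exists_integral_conj_linC_pow_mul_prod {α : Fin 4 → ℂ} (hα : α ∈ paramSet) (N : ℕ) :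
    ∃ κ : ℂ, κ ≠ 0 ∧ ∀ b : Fin N → Fin 4 → ℂ,
      ∫ ω : S3, (starRingEnd ℂ) (linC α ω) ^ N * ∏ k, linC (b k) ω ∂surfaceMeasure
        = κ * ∏ k, ∑ i, (starRingEnd ℂ) (α i) * b k i := by
  set c : ℂ := ∫ r : Set.Ioi (0 : ℝ), ((r : ℝ) : ℂ) ^ (N + N) *
    (Real.exp (-((r : ℝ) ^ 2 / 2)) : ℂ) ∂(Measure.volumeIoiPow 3)
  have hG : (∫ x : E4, (gauss x : ℂ)) ≠ 0 := by
    rw [integral_complex_ofReal]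
    exact_mod_cast integral_gauss_pos.ne'
  have key : ∀ b : Fin N → Fin 4 → ℂ,
      (∫ ω : S3, (starRingEnd ℂ) (linC α ω) ^ N * ∏ k, linC (b k) ω ∂surfaceMeasure) * c
        = N.factorial * (∏ k, ∑ i, (starRingEnd ℂ) (α i) * b k i) * ∫ x : E4, (gauss x : ℂ) := by
    intro b
    rw [← integral_linC_pow_mul_prod_gauss (sum_sq_eq_zero hα) b N Finset.univ (by simp),
      integral_homogeneous_mul_gauss (k := N + N)]
    · simp only [conj_linC]
      rfl
    · intro r x
      simp only [linC_smul, mul_pow, Finset.prod_mul_distrib, Finset.prod_const, Finset.card_univ,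
        Fintype.card_fin]
      ring
  -- With every `b k` equal to `α` the right-hand side is `N! 2^N ∫ gauss ≠ 0`, so the radial
  -- integral need not be evaluated.
  have hc : c ≠ 0 := by
    intro h0
    have := key fun _ => α
    rw [h0, mul_zero, sum_conj_mul_self hα] at this
    simp [hG, Nat.factorial_ne_zero] at this
  refine ⟨N.factorial * (∫ x : E4, (gauss x : ℂ)) / c, ?_, fun b => ?_⟩
  · have : (N.factorial : ℂ) ≠ 0 := by exact_mod_cast N.factorial_ne_zero
    positivity
  · field_simp
    rw [key b]
    ring

/-- The component of `Φ_{α,N}` belonging to a choice of an eigenspace in each factor. -/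
noncomputable def phiComp (α : Fin 4 → ℂ) (N : ℕ) (σ : Fin N → Fin 3) : C(S3, ℂ) :=
  (normConst α N : ℂ) • ∏ k, linS (eigComp α (σ k))

theorem phiComp_apply (α : Fin 4 → ℂ) (N : ℕ) (σ : Fin N → Fin 3) (ω : S3) :
    phiComp α N σ ω = (normConst α N : ℂ) * ∏ k, linC (eigComp α (σ k)) ω := by
  simp [phiComp, linS_apply]

/-- `Φ_{α,N}` as a continuous map. -/
noncomputable def phiMap (α : Fin 4 → ℂ) (N : ℕ) : C(S3, ℂ) := ⟨Phi α N, continuous_Phi α N⟩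

theorem phiMap_eq_sum (α : Fin 4 → ℂ) (N : ℕ) : phiMap α N = ∑ σ, phiComp α N σ := by
  have h : phiMap α N = (normConst α N : ℂ) • linS α ^ N := by
    ext ω
    simp [phiMap, Phi, linS_apply, linC, cdot]
  rw [h, ← sum_eigComp, Fintype.sum_pow, Finset.smul_sum]
  rfl

theorem Psi_eq (α : Fin 4 → ℂ) (N : ℕ) :
    Psi α N = sphereState (N + 1) (by positivity) (phiMap α N) := rfl

theorem phiComp_stereo_rot (α : Fin 4 → ℂ) (N : ℕ) (σ : Fin N → Fin 3) (θ : ℝ) (p : E3) :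
    phiComp α N σ (stereo (rot θ p))
      = Complex.exp (θ * (∑ k, eigVal (σ k) : ℝ) * Complex.I) * phiComp α N σ (stereo p) := by
  simp only [phiComp_apply, linC_eigComp_stereo_rot, Finset.prod_mul_distrib, ← Complex.exp_sum]
  rw [Complex.ofReal_sum, Finset.mul_sum, Finset.sum_mul]
  ring

theorem inner_Psi_phiComp {α : Fin 4 → ℂ} (hα : α ∈ paramSet) (N : ℕ) (σ : Fin N → Fin 3) :
    inner ℂ (Psi α N) (sphereState (N + 1) (by positivity) (phiComp α N σ))
      = ((∏ k, eigWeight α (σ k) : ℝ) : ℂ) := by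
  obtain ⟨κ, hκ, hint⟩ := exists_integral_conj_linC_pow_mul_prod hα N
  -- The choice `b k = α` expresses the normalization through the same `κ`, which therefore cancels;
  -- the powers of `2` cancel against those of `sum_conj_mul_eigComp`.
  have hnorm : ((∫ ω, ‖cdot α ω ^ N‖ ^ 2 ∂surfaceMeasure : ℝ) : ℂ) = κ * 2 ^ N := by
    have := hint fun _ => α
    simp only [sum_conj_mul_self hα, Finset.prod_const, Finset.card_univ, Fintype.card_fin] at this
    rw [← this, ← integral_complex_ofReal]
    refine integral_congr_ae (Filter.Eventually.of_forall fun ω => ?_)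
    simp only
    rw [Complex.ofReal_pow, ← Complex.conj_mul', map_pow]
    rfl
  have ha : (normConst α N : ℂ) * normConst α N = (κ * 2 ^ N)⁻¹ := by
    rw [← hnorm, ← Complex.ofReal_mul, normConst, ← mul_inv, Real.mul_self_sqrt
      (integral_nonneg fun ω => by positivity), Complex.ofReal_inv]
  rw [Psi_eq, inner_sphereState (by positivity)]
  set F : S3 → ℂ := fun ω => (starRingEnd ℂ) (phiMap α N ω) * phiComp α N σ ω with hF
  have hFc : Continuous F := by
    rw [hF]
    fun_prop
  have hfin : IsFiniteMeasure surfaceMeasure := by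
    unfold surfaceMeasure
    infer_instance
  have hFω : ∀ ω, F ω = (normConst α N : ℂ) * normConst α N *
      ((starRingEnd ℂ) (linC α ω) ^ N * ∏ k, linC (eigComp α (σ k)) ω) := by
    intro ω
    have : phiMap α N ω = (normConst α N : ℂ) * linC α ω ^ N := rfl
    simp only [hF, this, phiComp_apply, map_mul, Complex.conj_ofReal, map_pow]
    ring
  -- Both factors of `F` are homogeneous of degree `N`, so `F` is even and `ω₄ F` is odd.
  have hFeven : ∀ ω, F (-ω) = F ω := by
    intro ω
    have hneg : ∀ a : Fin 4 → ℂ, linC a ((-ω : S3) : E4) = -linC a ω := by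
      intro a
      simp [linC]
    have h1 : (-1 : ℂ) ^ N * (-1) ^ N = 1 := by
      rw [← mul_pow]
      simp
    simp only [hFω, hneg, map_neg, Finset.prod_neg, Finset.card_univ, Fintype.card_fin]
    rw [neg_pow]
    linear_combination (normConst α N * normConst α N * (starRingEnd ℂ) (linC α ω) ^ N *
      ∏ k, linC (eigComp α (σ k)) ω) * h1
  have hint' : ∀ f : S3 → ℂ, Continuous f → Integrable f surfaceMeasure := fun f hf =>
    hf.integrable_of_hasCompactSupport (HasCompactSupport.of_compactSpace f)
  have hodd : ∫ ω : S3, ((ω.1 3 : ℝ) : ℂ) * F ω ∂surfaceMeasure = 0 := by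
    refine integral_surfaceMeasure_eq_zero_of_odd fun ω => ?_
    rw [hFeven]
    simp
  calc ∫ ω : S3, ((1 - ω.1 3 : ℝ) : ℂ) * F ω ∂surfaceMeasure
      = ∫ ω : S3, (F ω - ((ω.1 3 : ℝ) : ℂ) * F ω) ∂surfaceMeasure := by
        congr 1
        funext ω
        push_cast
        ring
    _ = ∫ ω : S3, F ω ∂surfaceMeasure := by
        rw [integral_sub (hint' _ hFc) (hint' _ (by fun_prop)), hodd, sub_zero]
    _ = (κ * 2 ^ N)⁻¹ * (κ * ∏ k, ∑ i, (starRingEnd ℂ) (α i) * eigComp α (σ k) i) := by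
        simp only [hFω]
        rw [integral_const_mul, hint, ha]
    _ = _ := by
        simp only [sum_conj_mul_eigComp, Finset.prod_mul_distrib, Finset.prod_const,
          Finset.card_univ, Fintype.card_fin]
        push_cast
        field_simp

/-! ### Expectation values of powers of the angular momentum -/

theorem proposition5p1 (B : ℝ) (m : ℕ) (hm : 0 < m) :
    ∃ C : ℝ, ∀ N : ℕ, 1 ≤ N → ∀ α ∈ paramSet,
      ∃ hΨ : Psi α N ∈
          (opPow (((1 / ((N : ℝ) + 1) * (-B / 2) : ℝ) : ℂ) • L3) m).domain,
        ‖inner ℂ (Psi α N)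
            (opPow (((1 / ((N : ℝ) + 1) * (-B / 2) : ℝ) : ℂ) • L3) m ⟨Psi α N, hΨ⟩)
          - (((-B / 2 * ell3 α) ^ m : ℝ) : ℂ)‖ ≤ C / (N : ℝ) := by
  refine ⟨|-B / 2| ^ m * (m + m ^ 2), fun N hN α hα => ?_⟩
  set c : ℝ := 1 / ((N : ℝ) + 1) * (-B / 2) with hc
  have hr : ((N : ℝ) + 1) ≠ 0 := by positivity
  set X : (Fin N → Fin 3) → ℝ := fun σ => ∑ k, eigVal (σ k)
  set ψ : (Fin N → Fin 3) → L2R3 := fun σ => sphereState (N + 1) hr (phiComp α N σ) with hψ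
  have hsum : Psi α N = ∑ σ, ψ σ := by
    rw [Psi_eq, phiMap_eq_sum, map_sum]
  -- The graph of the power is a subspace, so adding up the eigenvectors gives both the domain
  -- membership of `Psi α N` and the value on it.
  have hgraph : (Psi α N, ∑ σ, ((c : ℂ) * X σ) ^ m • ψ σ) ∈ (opPow ((c : ℂ) • L3) m).graph := by
    have hσ : ∀ σ, (ψ σ, ((c : ℂ) * X σ) ^ m • ψ σ) ∈ (opPow ((c : ℂ) • L3) m).graph := by
      intro σ
      refine mem_graph_opPow ?_ m
      rw [mul_smul]
      exact mem_graph_smul _ (mem_graph_L3_sphereState hr (phiComp_stereo_rot α N σ))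
    have := Submodule.sum_mem _ fun σ (_ : σ ∈ Finset.univ) => hσ σ
    rwa [← prod_mk_sum, ← hsum] at this
  obtain ⟨⟨y, hy⟩, rfl, hval⟩ := (LinearPMap.mem_graph_iff _).1 hgraph
  refine ⟨hy, ?_⟩
  -- The `σ`-term pairs to a product of weights, so this is the `m`-th moment of `X / (N + 1)`
  -- scaled by `(-B/2)^m`.
  have hinner : inner ℂ (Psi α N) (∑ σ, ((c : ℂ) * X σ) ^ m • ψ σ)
      = (((-B / 2) ^ m * ∑ σ, (∏ k, eigWeight α (σ k)) * (X σ / (N + 1)) ^ m : ℝ) : ℂ) := by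
    rw [inner_sum, Finset.mul_sum, Complex.ofReal_sum]
    refine Finset.sum_congr rfl fun σ _ => ?_
    rw [inner_smul_right, hψ, inner_Psi_phiComp hα, ← Complex.ofReal_mul, ← Complex.ofReal_pow,
      ← Complex.ofReal_mul, hc]
    congr 1
    rw [show 1 / ((N : ℝ) + 1) * (-B / 2) * X σ = -B / 2 * (X σ / (N + 1)) by ring, mul_pow]
    ring
  rw [hval, hinner, ← Complex.ofReal_sub, Complex.norm_real, mul_pow, ← mul_sub, norm_mul,
    Real.norm_eq_abs, Real.norm_eq_abs, abs_pow, mul_div_assoc]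
  gcongr
  exact abs_moment_sub_pow_le (eigWeight_nonneg α) (sum_eigWeight hα) abs_eigVal_le
    (sum_eigWeight_mul_eigVal α) m hN
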